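/- **Theorem.** Conventions. A configuration over a finite alphabet $A$ is a map $x:\mathbb Z^2\to A$; a finite pattern is a map from a finite subset of $\mathbb Z^2$ to $A$. A subshift over $A$ is the set of all configurations in which no pattern from some set $F$ of finite patterns occurs; it is an SFT if $F$ can be chosen finite. For $k\ge 0$, $\Pi^0_k$ denotes the class of subshifts whose language (the set of finite patterns occurring in its configurations) is a $\Pi^0_k$ set of the arithmetical hierarchy, under a computable coding of finite patterns. For a class $C$ of subshifts over finite alphabets, a $C$-u-MSO formula over $A$ is a formula $$\psi = Q_1X_1[\mathcal X_1]\cdots Q_rX_r[\mathcal X_r]\ \forall \vec n_1\cdots\forall \vec n_\ell\ \phi ,$$ where each $Q_i\in\{\forall,\exists\}$, the variable $X_i$ ranges over the configurations of a subshift $\mathcal X_i\in C$ over some finite alphabet $B_i$, each $\vec n_j$ ranges over $\mathbb Z^2$, and $\phi$ is a Boolean combination of the atomic formulas $t=t'$, $P_a(t)$ ("the letter at $t$ is $a$", $a\in A$) and $(X_i)_t=b$ ($b\in B_i$); here $t,t'$ are terms obtained from a variable $\vec n_j$ by finitely many applications of the four functions moving to the north, south, east and west neighbour. It defines the set $\mathcal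 X_\psi$ of configurations $x\in A^{\mathbb Z^2}$ in which $\psi$ is true. For $n\ge 1$, $\bar\Pi_n[C]$ denotes the class of all sets $\mathcal X_\psi$, where $\psi$ is a $C$-u-MSO formula whose string $Q_1\cdots Q_r$ consists of exactly $n$ maximal blocks of equal quantifiers, the first of which is universal. Then for all $k\ge 1$ and $n\ge 2$, $$\bar\Pi_n[\Pi^0_k]=\Pi^0_{k+1}.$$ Furthermore, $\bar\Pi_n[\mathrm{SFT}]=\Pi^0_2$ for all $n\ge 2$. -/

import Mathlib

namespace MSOShift

/-! ### Configurations, finite patterns, subshifts -/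

/-- The full shift over the alphabet `A`: all two-dimensional configurations. -/
abbrev Config (A : Type) : Type := ℤ × ℤ → A

/-- A finite pattern over `A`: a map from a finite set of coordinates to `A`. -/
structure FinPattern (A : Type) where
  dom : Finset (ℤ × ℤ)
  val : dom → A

variable {A : Type}

/-- The pattern `P` occurs in the configuration `x` at the coordinate `v`. -/
def FinPattern.OccursAt (P : FinPattern A) (x : Config A) (v : ℤ × ℤ) : Prop :=
  ∀ w : P.dom, x (v + (w : ℤ × ℤ)) = P.val w

/-- The pattern `P` occurs in the configuration `x`. -/
def FinPattern.OccursIn (P : FinPattern A) (x : Config A) : Prop :=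
  ∃ v : ℤ × ℤ, P.OccursAt x v

/-- The set of configurations in which no pattern of `F` occurs. -/
def avoiding (F : Set (FinPattern A)) : Set (Config A) :=
  {x | ∀ P ∈ F, ¬ P.OccursIn x}

/-- A subshift is a set of configurations defined by forbidden finite patterns. -/
def IsSubshift (X : Set (Config A)) : Prop :=
  ∃ F : Set (FinPattern A), X = avoiding F

/-- The language of `X`: all finite patterns that occur in an element of `X`. -/
def language (X : Set (Config A)) : Set (FinPattern A) :=
  {P | ∃ x ∈ X, P.OccursIn x}

/-! ### The arithmetical hierarchy -/

mutual

/-- `Σ⁰_k` predicates on a type with a computable coding: computable predicates for `k = 0`, and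
existential number quantification over `Π⁰_k` predicates at the next level. -/
def IsSigma : ℕ → ∀ {α : Type} [Primcodable α], (α → Prop) → Prop
  | 0, _, _, p => ComputablePred p
  | k + 1, α, _, p => ∃ q : α × ℕ → Prop, IsPi k q ∧ ∀ a, p a ↔ ∃ m : ℕ, q (a, m)

/-- `Π⁰_k` predicates on a type with a computable coding: computable predicates for `k = 0`, and
universal number quantification over `Σ⁰_k` predicates at the next level. -/
def IsPi : ℕ → ∀ {α : Type} [Primcodable α], (α → Prop) → Prop
  | 0, _, _, p => ComputablePred p
  | k + 1, α, _, p => ∃ q : α × ℕ → Prop, IsSigma k q ∧ ∀ a, p a ↔ ∀ m : ℕ, q (a, m)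

end

/-- The list `l` enumerates (in some order, possibly with repetitions) the graph of the pattern
`P`, where letters are numbered by `e`. -/
def Represents {m : ℕ} (e : A ≃ Fin m) (l : List ((ℤ × ℤ) × Fin m)) (P : FinPattern A) : Prop :=
  ∀ (v : ℤ × ℤ) (c : Fin m), (v, c) ∈ l ↔ ∃ h : v ∈ P.dom, e (P.val ⟨v, h⟩) = c

/-! ### Classes of subshifts -/

/-- A class of sets of configurations over finite alphabets. -/
abbrev ShiftClass : Type 1 := ∀ (A : Type) [Finite A], Set (Set (Config A))

/-- The class of subshifts of finite type. -/
def SFT : ShiftClass := fun A _ =>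
  {X | ∃ F : Set (FinPattern A), F.Finite ∧ X = avoiding F}

/-- The class `Π⁰_k` of subshifts whose language is a `Π⁰_k` set of finite patterns. The numbering
`e` of the finitely many letters is immaterial, since any two differ by a permutation. -/
def ArithPi (k : ℕ) : ShiftClass := fun A _ =>
  {X | IsSubshift X ∧ ∃ (m : ℕ) (e : A ≃ Fin m),
    IsPi k (fun l : List ((ℤ × ℤ) × Fin m) => ∃ P ∈ language X, Represents e l P)}

/-! ### Formulas -/

/-- The four adjacency functions. -/
inductive Dir
  | north | south | east | west

/-- The interpretation of the adjacency functions on the plane. -/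
def Dir.move : Dir → ℤ × ℤ → ℤ × ℤ
  | .north, v => (v.1, v.2 + 1)
  | .south, v => (v.1, v.2 - 1)
  | .east, v => (v.1 + 1, v.2)
  | .west, v => (v.1 - 1, v.2)

/-- Terms in `l` first-order variables: chains of adjacency functions applied to a variable. -/
inductive Term (l : ℕ)
  | var (i : Fin l) : Term l
  | app (d : Dir) (t : Term l) : Term l

/-- The coordinate denoted by a term under an assignment of the first-order variables. -/
def Term.eval {l : ℕ} (n : Fin l → ℤ × ℤ) : Term l → ℤ × ℤ
  | .var i => n i
  | .app d t => d.move (t.eval n)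

/-- Quantifier-free formulas over the alphabet `A`, in `r` configuration variables with alphabets
`B 0, …, B (r - 1)` and in `l` first-order variables. The atomic formulas are `t = t'`, `P_a(t)`
and `(X_i)_t = b`. -/
inductive QFFormula (A : Type) {r : ℕ} (B : Fin r → Type) (l : ℕ)
  | eq (t t' : Term l) : QFFormula A B l
  | symb (a : A) (t : Term l) : QFFormula A B l
  | conf (i : Fin r) (b : B i) (t : Term l) : QFFormula A B l
  | not (φ : QFFormula A B l) : QFFormula A B l
  | and (φ ψ : QFFormula A B l) : QFFormula A B l
  | or (φ ψ : QFFormula A B l) : QFFormula A B l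

/-- Truth of a quantifier-free formula in the structure of the configuration `x`, with values `y`
for the configuration variables and `n` for the first-order variables. -/
def QFFormula.Holds {r : ℕ} {B : Fin r → Type} {l : ℕ} (x : Config A)
    (y : ∀ i, Config (B i)) (n : Fin l → ℤ × ℤ) : QFFormula A B l → Prop
  | .eq t t' => t.eval n = t'.eval n
  | .symb a t => x (t.eval n) = a
  | .conf i b t => y i (t.eval n) = b
  | .not φ => ¬ φ.Holds x y n
  | .and φ ψ => φ.Holds x y n ∧ ψ.Holds x y n
  | .or φ ψ => φ.Holds x y n ∨ ψ.Holds x y n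

/-- The two quantifiers. -/
inductive Quant
  | all | ex
  deriving DecidableEq

/-- Quantification of `y` over the set `S`. -/
def Quant.Over {β : Type} (Q : Quant) (S : Set β) (K : β → Prop) : Prop :=
  match Q with
  | .all => ∀ y ∈ S, K y
  | .ex => ∃ y ∈ S, K y

/-- Truth of `Q 0 y_0 ∈ X 0, …, Q (r - 1) y_(r-1) ∈ X (r - 1), K y`. -/
def PrefixHolds : ∀ {r : ℕ} (_Q : Fin r → Quant) (B : Fin r → Type)
    (_X : ∀ i, Set (Config (B i))) (_K : (∀ i, Config (B i)) → Prop), Prop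
  | 0, _, _, _, K => K (fun i => i.elim0)
  | _ + 1, Q, B, X, K =>
      (Q 0).Over (X 0) fun y =>
        PrefixHolds (fun i => Q i.succ) (fun i => B i.succ) (fun i => X i.succ)
          fun ys => K (Fin.cons y ys)

/-- Formulas `Q₁ X₁[𝒳₁] ⋯ Q_r X_r[𝒳_r] ∀ n₁ ⋯ ∀ n_l φ` over the alphabet `A`, where `φ` is
quantifier-free and every `𝒳_i` is a set of configurations over a finite alphabet. -/
structure UFormula (A : Type) where
  r : ℕ
  quant : Fin r → Quant
  alph : Fin r → Type
  finite_alph : ∀ i, Finite (alph i)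
  range : ∀ i, Set (Config (alph i))
  l : ℕ
  body : QFFormula A alph l

/-- The configuration `x` models the formula `ψ`. -/
def UFormula.Models (x : Config A) (ψ : UFormula A) : Prop :=
  PrefixHolds ψ.quant ψ.alph ψ.range fun y => ∀ n : Fin ψ.l → ℤ × ℤ, ψ.body.Holds x y n

/-- The set of configurations that model `ψ`. -/
def UFormula.models (ψ : UFormula A) : Set (Config A) := {x | UFormula.Models x ψ}

/-- The formula `ψ` is over the class `C`: the ranges of its configuration variables are in `C`. -/
def UFormula.IsOver (C : ShiftClass) (ψ : UFormula A) : Prop :=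
  ∀ i, ψ.range i ∈ @C (ψ.alph i) (ψ.finite_alph i)

/-- The number of maximal blocks of equal consecutive quantifiers. -/
def blockCount : List Quant → ℕ
  | [] => 0
  | [_] => 1
  | a :: b :: t => if a = b then blockCount (b :: t) else blockCount (b :: t) + 1

/-- `ψ` is a `Π̄_n` formula: its second-order quantifiers form `n` alternating blocks, the first of
which (if any) is universal. -/
def UFormula.IsPiBar (n : ℕ) (ψ : UFormula A) : Prop :=
  blockCount (List.ofFn ψ.quant) = n ∧ ∀ Q ∈ (List.ofFn ψ.quant).head?, Q = Quant.all

/-- The class `Π̄_n[C]` of sets defined by `Π̄_n` formulas over `C`. -/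
def PiBar (n : ℕ) (C : ShiftClass) : ShiftClass := fun A _ =>
  {X | ∃ ψ : UFormula A, ψ.IsOver C ∧ ψ.IsPiBar n ∧ X = ψ.models}

end MSOShift

namespace MSOShift

/-! ### Primitive recursion on the integers -/

section IntPrimrec

-- Call a set of configurations effectively closed at level `k` (`EffClosed`) if it is cut out by a
-- Σ⁰_k set of finite obstructions at fixed coordinates. By compactness, for `k ≥ 1` the
-- shift-invariant sets of this kind are exactly the subshifts in Π⁰_k (`mem_arithPi_iff`).
--
-- Upper bound. The matrix `∀ n, φ` is effectively closed at level 1. Existential quantification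
-- over an effectively closed set is a projection, and compactness keeps the level: a finite pattern
-- has no lift iff finitely many obstructions cover all its lifts, which can be searched for. Under
-- universal quantification over `Y`, the new obstructions are the visible parts of obstructions of
-- the matrix whose hidden part extends to an element of `Y`. If `Y` has level `k`, extendability is
-- Π⁰_k, so a matrix of level `k + 1` keeps that level. Thus a prefix of any length costs a single
-- level in all (`effClosed_prefixHolds`).
--
-- Lower bound. Let `X` be in Π⁰_(k+1). An obstruction of `X`, together with the witness of its
-- outermost existential quantifier, is coded as a bit word driving a walk on the plane; the coding
-- words form a Π⁰_k set `G` (`exists_forbidden_walks`). The universal variable ranges over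
-- labellings that write a word of `G` on the columns and mark an origin. The existential variable
-- then exhibits one place where `x` disagrees with the walk started at that origin: it chooses a
-- column, draws the two coordinate functions of the walk as graphs, and carries the two coordinates
-- to the cell in question by a row, a diagonal and a column. These rules are local
-- (`mem_piBar_of_layouts`), and further quantifier blocks are dummies.
--
-- What remains is to force the written words to lie in `G`. For the class Π⁰_k, the written words
-- outside `G` are simply forbidden (`Walker.exists_arithPi_layouts`). For SFTs and `k = 1`, the
-- rows above the origin display an infinite run of a Turing machine that halts exactly on the words
-- outside `G` (`Walker.exists_sft_layouts`).

theorem primrec_intToNat : Primrec Int.toNat := by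
  -- An integer `n ≥ 0` has code `2n` and `-(n + 1)` has code `2n + 1`, so the parity of the code is
  -- the sign.
  have h : Primrec fun z : ℤ =>
      if Encodable.encode z % 2 = 0 then Encodable.encode z / 2 else 0 :=
    Primrec.ite
      (Primrec.eq.comp (Primrec.nat_mod.comp Primrec.encode (Primrec.const 2)) (Primrec.const 0))
      (Primrec.nat_div.comp Primrec.encode (Primrec.const 2)) (Primrec.const 0)
  refine h.of_eq fun z => ?_
  cases z with
  | ofNat n =>
    have : Encodable.encode (Int.ofNat n) = 2 * n := rfl
    rw [this]; simp
  | negSucc n =>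
    have : Encodable.encode (Int.negSucc n) = 2 * n + 1 := rfl
    rw [this]
    simp

theorem primrec_intNegToNat : Primrec fun z : ℤ => (-z).toNat := by
  have h : Primrec fun z : ℤ =>
      if Encodable.encode z % 2 = 0 then 0 else Encodable.encode z / 2 + 1 :=
    Primrec.ite
      (Primrec.eq.comp (Primrec.nat_mod.comp Primrec.encode (Primrec.const 2)) (Primrec.const 0))
      (Primrec.const 0)
      (Primrec.succ.comp (Primrec.nat_div.comp Primrec.encode (Primrec.const 2)))
  refine h.of_eq fun z => ?_
  cases z with
  | ofNat n =>
    have : Encodable.encode (Int.ofNat n) = 2 * n := rfl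
    rw [this]; simp
  | negSucc n =>
    have : Encodable.encode (Int.negSucc n) = 2 * n + 1 := rfl
    rw [this]
    have h2 : (2 * n + 1) / 2 = n := by omega
    simp [h2]

theorem primrec_natSubInt : Primrec₂ fun a b : ℕ => (a : ℤ) - b := by
  have h : Primrec₂ fun a b : ℕ => if b ≤ a then 2 * (a - b) else 2 * (b - a - 1) + 1 := by
    refine Primrec.ite (Primrec.nat_le.comp Primrec.snd Primrec.fst)
      (Primrec.nat_double.comp (Primrec.nat_sub.comp Primrec.fst Primrec.snd))
      (Primrec.nat_double_succ.comp (Primrec.nat_sub.comp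
        (Primrec.nat_sub.comp Primrec.snd Primrec.fst) (Primrec.const 1)))
  refine Primrec₂.encode_iff.1 (h.of_eq fun a b => ?_)
  split_ifs with hab
  · have : (a : ℤ) - b = Int.ofNat (a - b) := by simp; omega
    rw [this]; rfl
  · have : (a : ℤ) - b = Int.negSucc (b - a - 1) := by omega
    rw [this]; rfl

theorem primrec_intAdd : Primrec₂ fun a b : ℤ => a + b := by
  have h : Primrec₂ fun a b : ℤ => ((a.toNat + b.toNat : ℕ) : ℤ) -
      (((-a).toNat + (-b).toNat : ℕ) : ℤ) :=
    primrec_natSubInt.comp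
      (Primrec.nat_add.comp (primrec_intToNat.comp Primrec.fst) (primrec_intToNat.comp Primrec.snd))
      (Primrec.nat_add.comp (primrec_intNegToNat.comp Primrec.fst)
        (primrec_intNegToNat.comp Primrec.snd))
  refine h.of_eq fun a b => ?_
  omega

theorem primrec_planeAdd : Primrec₂ fun a b : ℤ × ℤ => a + b :=
  Primrec.pair
    (primrec_intAdd.comp (Primrec.fst.comp Primrec.fst) (Primrec.fst.comp Primrec.snd))
    (primrec_intAdd.comp (Primrec.snd.comp Primrec.fst) (Primrec.snd.comp Primrec.snd))

end IntPrimrec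

/-! ### Closure properties of the arithmetical hierarchy -/

section Hierarchy

variable {α β γ : Type} [Primcodable α] [Primcodable β] [Primcodable γ]

theorem isSigma_zero {p : α → Prop} : IsSigma 0 p ↔ ComputablePred p := by
  simp only [IsSigma]

theorem isPi_zero {p : α → Prop} : IsPi 0 p ↔ ComputablePred p := by
  simp only [IsPi]

theorem isSigma_succ {k : ℕ} {p : α → Prop} :
    IsSigma (k + 1) p ↔ ∃ q : α × ℕ → Prop, IsPi k q ∧ ∀ a, p a ↔ ∃ m : ℕ, q (a, m) := by
  simp only [IsSigma]

theorem isPi_succ {k : ℕ} {p : α → Prop} :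
    IsPi (k + 1) p ↔ ∃ q : α × ℕ → Prop, IsSigma k q ∧ ∀ a, p a ↔ ∀ m : ℕ, q (a, m) := by
  simp only [IsPi]

theorem IsSigma.of_iff {k : ℕ} {p q : α → Prop} (h : IsSigma k p) (hpq : ∀ a, p a ↔ q a) :
    IsSigma k q :=
  (funext fun a => propext (hpq a) : p = q) ▸ h

theorem IsPi.of_iff {k : ℕ} {p q : α → Prop} (h : IsPi k p) (hpq : ∀ a, p a ↔ q a) :
    IsPi k q :=
  (funext fun a => propext (hpq a) : p = q) ▸ h

theorem computablePred_not {p : α → Prop} (h : ComputablePred p) :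
    ComputablePred fun a => ¬ p a := by
  obtain ⟨_, h⟩ := h
  exact ⟨inferInstance, (Primrec.not.to_comp.comp h).of_eq fun a => by simp⟩

theorem computablePred_comp {p : β → Prop} {f : α → β} (h : ComputablePred p)
    (hf : Computable f) : ComputablePred fun a => p (f a) := by
  obtain ⟨_, h⟩ := h
  exact ⟨inferInstance, h.comp hf⟩

theorem computablePred_and {p q : α → Prop} (h : ComputablePred p) (h' : ComputablePred q) :
    ComputablePred fun a => p a ∧ q a := by
  obtain ⟨_, h⟩ := h
  obtain ⟨_, h'⟩ := h'
  exact ⟨inferInstance, (Primrec.and.to_comp.comp h h').of_eq fun a => by simp⟩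

/-- Each level of one hierarchy is built from the previous level of the other, so both halves go
through one induction; the type varies because the matrix lives on `α × ℕ`. The same shape recurs in
the closure lemmas below. -/
theorem isSigma_isPi_not (k : ℕ) : ∀ {α : Type} [Primcodable α] {p : α → Prop},
    (IsSigma k p → IsPi k fun a => ¬ p a) ∧ (IsPi k p → IsSigma k fun a => ¬ p a) := by
  induction k with
  | zero =>
    intro α _ p
    rw [isSigma_zero, isPi_zero, isSigma_zero, isPi_zero]
    exact ⟨computablePred_not, computablePred_not⟩
  | succ k ih =>
    intro α _ p
    rw [isSigma_succ, isPi_succ, isSigma_succ, isPi_succ]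
    constructor
    · rintro ⟨q, hq, h⟩
      exact ⟨_, ih.2 hq, fun a => by simp [h a]⟩
    · rintro ⟨q, hq, h⟩
      exact ⟨_, ih.1 hq, fun a => by simp [h a]⟩

theorem IsSigma.not {k : ℕ} {p : α → Prop} (h : IsSigma k p) : IsPi k fun a => ¬ p a :=
  (isSigma_isPi_not k).1 h

theorem IsPi.not {k : ℕ} {p : α → Prop} (h : IsPi k p) : IsSigma k fun a => ¬ p a :=
  (isSigma_isPi_not k).2 h

theorem IsSigma.of_not {k : ℕ} {p : α → Prop} (h : IsPi k fun a => ¬ p a) : IsSigma k p :=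
  h.not.of_iff fun _ => not_not

theorem IsPi.of_not {k : ℕ} {p : α → Prop} (h : IsSigma k fun a => ¬ p a) : IsPi k p :=
  h.not.of_iff fun _ => not_not

theorem isSigma_isPi_comp (k : ℕ) : ∀ {α β : Type} [Primcodable α] [Primcodable β]
    {p : β → Prop} {f : α → β}, Computable f →
    (IsSigma k p → IsSigma k fun a => p (f a)) ∧ (IsPi k p → IsPi k fun a => p (f a)) := by
  induction k with
  | zero =>
    intro α β _ _ p f hf
    rw [isSigma_zero, isPi_zero, isSigma_zero, isPi_zero]
    exact ⟨fun h => computablePred_comp h hf, fun h => computablePred_comp h hf⟩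
  | succ k ih =>
    intro α β _ _ p f hf
    have hg : Computable fun x : α × ℕ => (f x.1, x.2) :=
      Computable.pair (hf.comp Computable.fst) Computable.snd
    rw [isSigma_succ, isPi_succ, isSigma_succ, isPi_succ]
    constructor
    · rintro ⟨q, hq, h⟩
      exact ⟨_, (ih hg).2 hq, fun a => h (f a)⟩
    · rintro ⟨q, hq, h⟩
      exact ⟨_, (ih hg).1 hq, fun a => h (f a)⟩

theorem IsSigma.comp {k : ℕ} {p : β → Prop} {f : α → β} (h : IsSigma k p) (hf : Computable f) :
    IsSigma k fun a => p (f a) :=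
  (isSigma_isPi_comp k hf).1 h

theorem IsPi.comp {k : ℕ} {p : β → Prop} {f : α → β} (h : IsPi k p) (hf : Computable f) :
    IsPi k fun a => p (f a) :=
  (isSigma_isPi_comp k hf).2 h

theorem isSigma_isPi_and (k : ℕ) : ∀ {α : Type} [Primcodable α] {p q : α → Prop},
    (IsSigma k p → IsSigma k q → IsSigma k fun a => p a ∧ q a) ∧
    (IsPi k p → IsPi k q → IsPi k fun a => p a ∧ q a) := by
  induction k with
  | zero =>
    intro α _ p q
    simp only [isSigma_zero, isPi_zero]
    exact ⟨computablePred_and, computablePred_and⟩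
  | succ k ih =>
    intro α _ p q
    simp only [isSigma_succ, isPi_succ]
    constructor
    · rintro ⟨p', hp', hp⟩ ⟨q', hq', hq⟩
      -- One number codes the witnesses of both conjuncts.
      have h1 : Computable fun x : α × ℕ => (x.1, x.2.unpair.1) :=
        Computable.pair Computable.fst
          (Computable.fst.comp (Primrec.unpair.to_comp.comp Computable.snd))
      have h2 : Computable fun x : α × ℕ => (x.1, x.2.unpair.2) :=
        Computable.pair Computable.fst
          (Computable.snd.comp (Primrec.unpair.to_comp.comp Computable.snd))
      refine ⟨_, ih.2 (hp'.comp h1) (hq'.comp h2), fun a => ?_⟩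
      rw [hp a, hq a]
      constructor
      · rintro ⟨⟨m, hm⟩, n, hn⟩
        exact ⟨Nat.pair m n, by simpa using ⟨hm, hn⟩⟩
      · rintro ⟨n, hn⟩
        exact ⟨⟨_, hn.1⟩, _, hn.2⟩
    · rintro ⟨p', hp', hp⟩ ⟨q', hq', hq⟩
      refine ⟨_, ih.1 hp' hq', fun a => ?_⟩
      rw [hp a, hq a, forall_and]

theorem IsSigma.and {k : ℕ} {p q : α → Prop} (hp : IsSigma k p) (hq : IsSigma k q) :
    IsSigma k fun a => p a ∧ q a :=
  (isSigma_isPi_and k).1 hp hq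

theorem IsPi.and {k : ℕ} {p q : α → Prop} (hp : IsPi k p) (hq : IsPi k q) :
    IsPi k fun a => p a ∧ q a :=
  (isSigma_isPi_and k).2 hp hq

theorem IsSigma.or {k : ℕ} {p q : α → Prop} (hp : IsSigma k p) (hq : IsSigma k q) :
    IsSigma k fun a => p a ∨ q a :=
  .of_not ((hp.not.and hq.not).of_iff fun a => by rw [not_or])

theorem IsSigma.isPi_succ {k : ℕ} {p : α → Prop} (h : IsSigma k p) : IsPi (k + 1) p :=
  MSOShift.isPi_succ.2 ⟨_, h.comp Computable.fst, fun _ => by simp⟩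

theorem IsPi.isSigma_succ {k : ℕ} {p : α → Prop} (h : IsPi k p) : IsSigma (k + 1) p :=
  MSOShift.isSigma_succ.2 ⟨_, h.comp Computable.fst, fun _ => by simp⟩

theorem isSigma_isPi_mono (k : ℕ) : ∀ {α : Type} [Primcodable α] {p : α → Prop},
    (IsSigma k p → IsSigma (k + 1) p) ∧ (IsPi k p → IsPi (k + 1) p) := by
  induction k with
  | zero =>
    intro α _ p
    exact ⟨fun h => (isPi_zero.2 (isSigma_zero.1 h)).isSigma_succ,
      fun h => (isSigma_zero.2 (isPi_zero.1 h)).isPi_succ⟩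
  | succ k ih =>
    intro α _ p
    constructor
    · intro h
      obtain ⟨q, hq, h⟩ := isSigma_succ.1 h
      exact isSigma_succ.2 ⟨q, ih.2 hq, h⟩
    · intro h
      obtain ⟨q, hq, h⟩ := isPi_succ.1 h
      exact isPi_succ.2 ⟨q, ih.1 hq, h⟩

theorem IsSigma.succ {k : ℕ} {p : α → Prop} (h : IsSigma k p) : IsSigma (k + 1) p :=
  (isSigma_isPi_mono k).1 h

theorem IsSigma.mono {j k : ℕ} {p : α → Prop} (h : IsSigma j p) (hjk : j ≤ k) : IsSigma k p := by
  induction hjk with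
  | refl => exact h
  | step _ ih => exact ih.succ

theorem isSigma_of_computable {p : α → Prop} (h : ComputablePred p) (k : ℕ) : IsSigma k p :=
  (isSigma_zero.2 h).mono k.zero_le

theorem isSigma_of_primrec {p : α → Prop} (h : PrimrecPred p) (k : ℕ) : IsSigma k p :=
  isSigma_of_computable h.computablePred k

theorem isPi_of_primrec {p : α → Prop} (h : PrimrecPred p) (k : ℕ) : IsPi k p :=
  .of_not (isSigma_of_primrec h.not k)

-- Bounded quantification over options and lists

theorem computablePred_exists_mem_option {p : α × β → Prop} (h : ComputablePred p) :
    ComputablePred fun x : α × Option β => ∃ b ∈ x.2, p (x.1, b) := by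
  classical
  obtain ⟨_, h⟩ := h
  have h' : Computable fun x : α × Option β =>
      (Option.casesOn x.2 false fun b => decide (p (x.1, b)) : Bool) := by
    refine Computable.option_casesOn Computable.snd (Computable.const false) ?_
    exact h.comp (Computable.pair (Computable.fst.comp Computable.fst) Computable.snd)
  refine ⟨inferInstance, h'.of_eq fun x => ?_⟩
  rcases x with ⟨a, _ | b⟩ <;> simp

/-- An option has at most one element, so this quantifier commutes with both number quantifiers. It
handles the partiality of `decode` when a quantifier over a coded type is replaced by one over `ℕ`.
-/
theorem isSigma_isPi_exists_mem_option (k : ℕ) :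
    ∀ {α β : Type} [Primcodable α] [Primcodable β] {p : α × β → Prop},
    (IsSigma k p → IsSigma k fun x : α × Option β => ∃ b ∈ x.2, p (x.1, b)) ∧
    (IsPi k p → IsPi k fun x : α × Option β => ∃ b ∈ x.2, p (x.1, b)) := by
  induction k with
  | zero =>
    intro α β _ _ p
    simp only [isSigma_zero, isPi_zero]
    exact ⟨computablePred_exists_mem_option, computablePred_exists_mem_option⟩
  | succ k ih =>
    intro α β _ _ p
    have h1 : Computable fun y : (α × ℕ) × β => ((y.1.1, y.2), y.1.2) :=
      Computable.pair (Computable.pair (Computable.fst.comp Computable.fst) Computable.snd)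
        (Computable.snd.comp Computable.fst)
    have h2 : Computable fun y : (α × Option β) × ℕ => ((y.1.1, y.2), y.1.2) :=
      Computable.pair (Computable.pair (Computable.fst.comp Computable.fst) Computable.snd)
        (Computable.snd.comp Computable.fst)
    simp only [isSigma_succ, isPi_succ]
    constructor
    · rintro ⟨q, hq, h⟩
      refine ⟨_, ((ih (α := α × ℕ) (β := β)).2 (hq.comp h1)).comp h2, ?_⟩
      rintro ⟨a, o⟩
      simp only [h]
      constructor
      · rintro ⟨b, hb, m, hm⟩
        exact ⟨m, b, hb, hm⟩
      · rintro ⟨m, b, hb, hm⟩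
        exact ⟨b, hb, m, hm⟩
    · rintro ⟨q, hq, h⟩
      refine ⟨_, ((ih (α := α × ℕ) (β := β)).1 (hq.comp h1)).comp h2, ?_⟩
      rintro ⟨a, _ | b⟩ <;> simp [h]

theorem IsPi.exists_mem_option {k : ℕ} {p : α × β → Prop} (h : IsPi k p) :
    IsPi k fun x : α × Option β => ∃ b ∈ x.2, p (x.1, b) :=
  (isSigma_isPi_exists_mem_option k).2 h

/-- Existential quantification over any type with a computable coding preserves `Σ⁰_(k+1)`. -/
theorem IsSigma.exists {k : ℕ} {p : α × β → Prop} (h : IsSigma (k + 1) p) :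
    IsSigma (k + 1) fun a => ∃ b, p (a, b) := by
  obtain ⟨q, hq, h⟩ := isSigma_succ.1 h
  have h1 : Computable fun y : α × (β × ℕ) => ((y.1, y.2.1), y.2.2) :=
    Computable.pair (Computable.pair Computable.fst (Computable.fst.comp Computable.snd))
      (Computable.snd.comp Computable.snd)
  -- The element `b` and its witness `m` are merged into one number; numbers that code nothing
  -- decode to `none` and are rejected.
  have h2 : Computable fun y : α × ℕ => (y.1, (Encodable.decode y.2 : Option (β × ℕ))) :=
    Computable.pair Computable.fst (Computable.decode.comp Computable.snd)
  refine isSigma_succ.2 ⟨_, ((hq.comp h1).exists_mem_option).comp h2, fun a => ?_⟩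
  simp only [h]
  constructor
  · rintro ⟨b, m, hm⟩
    exact ⟨Encodable.encode (b, m), (b, m), by simp, hm⟩
  · rintro ⟨n, ⟨b, m⟩, -, hm⟩
    exact ⟨b, m, hm⟩

theorem computablePred_forall_mem_list {p : α → Prop} (h : ComputablePred p) :
    ComputablePred fun l : List α => ∀ a ∈ l, p a := by
  classical
  obtain ⟨_, h⟩ := h
  have h' : Computable fun l : List α => (Nat.rec true (fun i acc => acc &&
      (Option.casesOn l[i]? true fun a => decide (p a))) l.length : Bool) := by
    have h1 : Computable fun y : List α × ℕ × Bool => y.1[y.2.1]? :=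
      (Computable.list_getElem? (α := α)).comp Computable.fst (Computable.fst.comp Computable.snd)
    have h2 : Computable fun y : List α × ℕ × Bool =>
        (Option.casesOn y.1[y.2.1]? true fun a => decide (p a) : Bool) :=
      Computable.option_casesOn h1 (Computable.const true) (h.comp Computable.snd).to₂
    exact Computable.nat_rec Computable.list_length (Computable.const true)
      (Primrec.and.to_comp.comp (Computable.snd.comp Computable.snd) h2).to₂
  refine ⟨inferInstance, h'.of_eq fun l => ?_⟩
  have key : ∀ n, ((Nat.rec true (fun i acc => acc &&
      (Option.casesOn l[i]? true fun a => decide (p a))) n : Bool) = true) ↔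
      ∀ i < n, ∀ a, l[i]? = some a → p a := by
    intro n
    induction n with
    | zero => simp
    | succ n ih =>
      simp only [Bool.and_eq_true, ih, Nat.lt_succ_iff_lt_or_eq, or_imp, forall_and,
        forall_eq]
      cases h : l[n]? <;> simp
  rw [Bool.eq_iff_iff, key, decide_eq_true_iff]
  constructor
  · intro h a ha
    obtain ⟨i, hi, rfl⟩ := List.getElem_of_mem ha
    exact h i hi _ (List.getElem?_eq_getElem hi)
  · intro h i _ a ha
    exact h a (List.mem_of_getElem? ha)

theorem isSigma_isPi_forall_mem_list (k : ℕ) : ∀ {α : Type} [Primcodable α] {p : α → Prop},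
    (IsSigma k p → IsSigma k fun l : List α => ∀ a ∈ l, p a) ∧
    (IsPi k p → IsPi k fun l : List α => ∀ a ∈ l, p a) := by
  induction k with
  | zero =>
    intro α _ p
    simp only [isSigma_zero, isPi_zero]
    exact ⟨computablePred_forall_mem_list, computablePred_forall_mem_list⟩
  | succ k ih =>
    intro α _ p
    constructor
    · intro h
      obtain ⟨q, hq, h⟩ := isSigma_succ.1 h
      -- Witnesses for all members are guessed at once, as a list of pairs whose first components
      -- spell the given list.
      have h1 : PrimrecPred fun x : List α × List (α × ℕ) => x.2.map Prod.fst = x.1 :=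
        Primrec.eq.comp (Primrec.list_map Primrec.snd (Primrec.fst.comp Primrec.snd).to₂)
          Primrec.fst
      have h2 := ((isPi_of_primrec h1 k).and ((ih.2 hq).comp Computable.snd)).isSigma_succ.exists
      refine h2.of_iff fun l => ?_
      simp only [h]
      constructor
      · rintro ⟨L, rfl, hL⟩ a ha
        obtain ⟨⟨a, m⟩, hx, rfl⟩ := List.mem_map.1 ha
        exact ⟨m, hL _ hx⟩
      · intro hl
        choose! f hf using hl
        refine ⟨l.map fun a => (a, f a), by simp [Function.comp_def], fun x hx => ?_⟩
        obtain ⟨a, ha, rfl⟩ := List.mem_map.1 hx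
        exact hf a ha
    · intro h
      obtain ⟨q, hq, h⟩ := isPi_succ.1 h
      have h1 : Computable fun x : List α × ℕ => x.1.map fun a => (a, x.2) :=
        (Primrec.list_map Primrec.fst
          (Primrec.pair Primrec.snd (Primrec.snd.comp Primrec.fst)).to₂).to_comp
      refine MSOShift.isPi_succ.2 ⟨_, (ih.1 hq).comp h1, fun l => ?_⟩
      simp only [h, List.forall_mem_map]
      exact ⟨fun h m a ha => h a ha m, fun h a ha m => h m a ha⟩

theorem IsSigma.forall_mem_list {k : ℕ} {p : α → Prop} (h : IsSigma k p) :
    IsSigma k fun l : List α => ∀ a ∈ l, p a :=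
  (isSigma_isPi_forall_mem_list k).1 h

end Hierarchy

/-! ### Finite pattern codes and brute-force search -/

/-- The configuration `x`, read through `f`, agrees with the entries of `l`. -/
def Matches {A : Type} {m : ℕ} (f : A → Fin m) (l : List ((ℤ × ℤ) × Fin m)) (x : Config A) :
    Prop :=
  ∀ p ∈ l, f (x p.1) = p.2

/-- All words of length `n` over `Fin m`. -/
def allWords (m : ℕ) (n : ℕ) : List (List (Fin m)) :=
  Nat.rec [[]] (fun _ ws => ws.flatMap fun w => (List.finRange m).map fun c => c :: w) n

theorem mem_allWords {m n : ℕ} {w : List (Fin m)} : w ∈ allWords m n ↔ w.length = n := by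
  induction n generalizing w with
  | zero => simp [allWords]
  | succ n ih =>
    have : allWords m (n + 1) =
      (allWords m n).flatMap fun w => (List.finRange m).map fun c => c :: w := rfl
    rw [this, List.mem_flatMap]
    constructor
    · rintro ⟨w', hw', h⟩
      obtain ⟨c, -, rfl⟩ := List.mem_map.1 h
      simp [ih.1 hw']
    · intro h
      obtain ⟨c, w', rfl⟩ := List.exists_cons_of_length_eq_add_one h
      exact ⟨w', ih.2 (by simpa using h), List.mem_map.2 ⟨c, List.mem_finRange c, rfl⟩⟩

theorem primrec_allWords (m : ℕ) : Primrec (allWords m) := by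
  refine Primrec.nat_rec₁ (α := List (List (Fin m))) [[]] ?_
  have h : Primrec₂ fun (_ : ℕ × List (List (Fin m))) (w : List (Fin m)) =>
      (List.finRange m).map fun c => c :: w :=
    (Primrec.list_map (Primrec.const (List.finRange m))
      (Primrec.list_cons.comp Primrec.snd (Primrec.snd.comp Primrec.fst)).to₂).to₂
  exact Primrec.list_flatMap Primrec.snd h

/-- Every configuration matching `l` through `f` matches a member of `T`. -/
def Covers {m m' : ℕ} (f : Fin m → Fin m') (l : List ((ℤ × ℤ) × Fin m'))
    (T : List (List ((ℤ × ℤ) × Fin m))) : Prop :=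
  ∀ z : Config (Fin m), Matches f l z → ∃ t ∈ T, Matches id t z

/-- Only the coordinates mentioned in `l` and `T` matter, so configurations may be replaced by words
over the list `cs` of these coordinates. Repetitions in `cs` are harmless since `idxOf` always reads
the first occurrence. -/
theorem covers_iff {m m' : ℕ} (hm : m ≠ 0) (f : Fin m → Fin m') (l : List ((ℤ × ℤ) × Fin m'))
    (T : List (List ((ℤ × ℤ) × Fin m))) (cs : List (ℤ × ℤ))
    (hcs : cs = l.map Prod.fst ++ T.flatten.map Prod.fst) :
    Covers f l T ↔ ∀ s ∈ allWords m cs.length,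
      ¬ (∀ p ∈ l, (s[cs.idxOf p.1]?).map f = some p.2) ∨
        ∃ t ∈ T, ∀ p ∈ t, s[cs.idxOf p.1]? = some p.2 := by
  have hl : ∀ p ∈ l, p.1 ∈ cs := fun p hp => by
    rw [hcs]; exact List.mem_append_left _ (List.mem_map_of_mem hp)
  have hT : ∀ t ∈ T, ∀ p ∈ t, p.1 ∈ cs := fun t ht p hp => by
    rw [hcs]
    exact List.mem_append_right _ (List.mem_map_of_mem (List.mem_flatten.2 ⟨t, ht, hp⟩))
  have key : ∀ (s : List (Fin m)) (z : Config (Fin m)),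
      (∀ v ∈ cs, s[cs.idxOf v]? = some (z v)) →
      ((Matches f l z → ∃ t ∈ T, Matches id t z) ↔
      (¬ (∀ p ∈ l, (s[cs.idxOf p.1]?).map f = some p.2) ∨
        ∃ t ∈ T, ∀ p ∈ t, s[cs.idxOf p.1]? = some p.2)) := by
    intro s z h
    have h1 : Matches f l z ↔ ∀ p ∈ l, (s[cs.idxOf p.1]?).map f = some p.2 :=
      forall₂_congr fun p hp => by rw [h _ (hl p hp)]; simp
    have h2 : ∀ t ∈ T, (Matches id t z ↔ ∀ p ∈ t, s[cs.idxOf p.1]? = some p.2) :=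
      fun t ht => forall₂_congr fun p hp => by rw [h _ (hT t ht p hp)]; simp
    rw [h1, imp_iff_not_or]
    refine or_congr Iff.rfl (exists_congr fun t => and_congr_right fun ht => h2 t ht)
  constructor
  · intro h s hs
    have hs := mem_allWords.1 hs
    -- A word becomes a configuration by putting the letter `0` at all other coordinates; this needs
    -- a nonempty alphabet.
    refine (key s (fun v => (s[cs.idxOf v]?).getD ⟨0, Nat.pos_of_ne_zero hm⟩) ?_).1 (h _)
    intro v hv
    have : cs.idxOf v < s.length := by rw [hs]; exact List.idxOf_lt_length_of_mem hv
    simp [List.getElem?_eq_getElem this]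
  · intro h z
    refine (key (cs.map z) z ?_).2 (h _ (mem_allWords.2 (by simp)))
    intro v hv
    have : cs.idxOf v < cs.length := List.idxOf_lt_length_of_mem hv
    simp [List.getElem?_eq_getElem this]

theorem primrecRel_covers {m m' : ℕ} (hm : m ≠ 0) (f : Fin m → Fin m') :
    PrimrecPred fun y : List ((ℤ × ℤ) × Fin m') × List (List ((ℤ × ℤ) × Fin m)) =>
      Covers f y.1 y.2 := by
  have hidx : Primrec₂ fun (v : ℤ × ℤ) (l : List (ℤ × ℤ)) => l.idxOf v := by
    convert Primrec.list_idxOf (α := ℤ × ℤ)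
  have hlook : Primrec₂ fun (p : ℤ × ℤ) (b : List (ℤ × ℤ) × List (Fin m)) =>
      b.2[b.1.idxOf p]? :=
    Primrec.list_getElem?.comp (Primrec.snd.comp Primrec.snd)
      (hidx.comp Primrec.fst (Primrec.fst.comp Primrec.snd))
  have h1 : PrimrecRel fun (p : (ℤ × ℤ) × Fin m) (b : List (ℤ × ℤ) × List (Fin m)) =>
      b.2[b.1.idxOf p.1]? = some p.2 :=
    Primrec.eq.comp (hlook.comp (Primrec.fst.comp Primrec.fst) Primrec.snd)
      (Primrec.option_some.comp (Primrec.snd.comp Primrec.fst))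
  have h2 : PrimrecRel fun (p : (ℤ × ℤ) × Fin m') (b : List (ℤ × ℤ) × List (Fin m)) =>
      (b.2[b.1.idxOf p.1]?).map f = some p.2 :=
    Primrec.eq.comp
      (Primrec.option_map (hlook.comp (Primrec.fst.comp Primrec.fst) Primrec.snd)
        ((Primrec.dom_finite f).comp Primrec.snd).to₂)
      (Primrec.option_some.comp (Primrec.snd.comp Primrec.fst))
  have hcs : Primrec fun y : List ((ℤ × ℤ) × Fin m') × List (List ((ℤ × ℤ) × Fin m)) =>
      y.1.map Prod.fst ++ y.2.flatten.map Prod.fst :=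
    Primrec.list_append.comp
      (Primrec.list_map Primrec.fst (Primrec.fst.comp Primrec.snd).to₂)
      (Primrec.list_map (Primrec.list_flatten.comp Primrec.snd)
        (Primrec.fst.comp Primrec.snd).to₂)
  have hb : Primrec fun x : List (Fin m) ×
      (List ((ℤ × ℤ) × Fin m') × List (List ((ℤ × ℤ) × Fin m))) =>
      ((x.2.1.map Prod.fst ++ x.2.2.flatten.map Prod.fst, x.1) :
        List (ℤ × ℤ) × List (Fin m)) :=
    Primrec.pair (hcs.comp Primrec.snd) Primrec.fst
  have h3 := (h2.forall_mem_list.comp (Primrec.fst.comp Primrec.snd) hb).not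
  have h4 := h1.forall_mem_list.exists_mem_list.comp (Primrec.snd.comp Primrec.snd) hb
  have h5 := (h3.or h4).primrecRel.forall_mem_list
  refine (h5.comp ((primrec_allWords m).comp (Primrec.list_length.comp hcs)) Primrec.id).of_eq ?_
  rintro ⟨l, T⟩
  exact (covers_iff hm f l T _ rfl).symm

/-! ### Compactness -/

section Compactness

variable {A : Type} {m m' : ℕ}

theorem isClopen_matches [TopologicalSpace A] [DiscreteTopology A] (f : A → Fin m)
    (l : List ((ℤ × ℤ) × Fin m)) : IsClopen {x : Config A | Matches f l x} := by
  induction l with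
  | nil => simpa [Matches] using isClopen_univ
  | cons p l ih =>
    have : {x : Config A | Matches f (p :: l) x} =
        (fun x : Config A => x p.1) ⁻¹' {a | f a = p.2} ∩ {x | Matches f l x} := by
      ext x; simp [Matches]
    rw [this]
    exact ((isClopen_discrete _).preimage (continuous_apply p.1)).inter ih

/-- Patterns define clopen cylinders in a compact space, so a cover of a cylinder by cylinders has a
finite subcover. -/
theorem exists_finite_cover [Finite A] (f : A → Fin m) (g : A → Fin m')
    (S : List ((ℤ × ℤ) × Fin m') → Prop) (l : List ((ℤ × ℤ) × Fin m))
    (h : ∀ x : Config A, Matches f l x → ∃ t, S t ∧ Matches g t x) :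
    ∃ T : List (List ((ℤ × ℤ) × Fin m')), (∀ t ∈ T, S t) ∧
      ∀ x : Config A, Matches f l x → ∃ t ∈ T, Matches g t x := by
  let _ : TopologicalSpace A := ⊥
  have : DiscreteTopology A := ⟨rfl⟩
  obtain ⟨T, hT⟩ := (isClopen_matches f l).isClosed.isCompact.elim_finite_subcover
    (fun t : {t // S t} => {x : Config A | Matches g t.1 x})
    (fun t => (isClopen_matches g t.1).isOpen) (fun x hx => by
      obtain ⟨t, ht, hx⟩ := h x hx
      exact Set.mem_iUnion.2 ⟨⟨t, ht⟩, hx⟩)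
  refine ⟨T.toList.map Subtype.val, ?_, fun x hx => ?_⟩
  · intro t ht
    obtain ⟨t, -, rfl⟩ := List.mem_map.1 ht
    exact t.2
  · obtain ⟨t, ht, hx⟩ := Set.mem_iUnion₂.1 (hT hx)
    exact ⟨t.1, List.mem_map_of_mem (Finset.mem_toList.2 ht), hx⟩

end Compactness

/-! ### Effectively closed sets of configurations -/

/-- The set `X` is closed, with a `Σ⁰_k` set of finite (anchored) obstructions. -/
def EffClosed {A : Type} (k : ℕ) (X : Set (Config A)) : Prop :=
  ∃ (m : ℕ) (e : A ≃ Fin m) (S : List ((ℤ × ℤ) × Fin m) → Prop), IsSigma k S ∧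
    ∀ x, x ∈ X ↔ ∀ l, S l → ¬ Matches e l x

/-- The set `X` is invariant under translations. -/
def ShiftInvariant {A : Type} (X : Set (Config A)) : Prop :=
  ∀ x ∈ X, ∀ v : ℤ × ℤ, (fun w => x (v + w)) ∈ X

section EffClosed

variable {A C U : Type} {k m : ℕ}

theorem primrec_mapLetters {m m' : ℕ} (f : Fin m → Fin m') :
    Primrec fun l : List ((ℤ × ℤ) × Fin m) => l.map fun p => (p.1, f p.2) :=
  Primrec.list_map Primrec.id (Primrec.pair (Primrec.fst.comp Primrec.snd)
    ((Primrec.dom_finite f).comp (Primrec.snd.comp Primrec.snd))).to₂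

theorem EffClosed.mono {j : ℕ} {X : Set (Config A)} (h : EffClosed j X) (hjk : j ≤ k) :
    EffClosed k X := by
  obtain ⟨m, e, S, hS, h⟩ := h
  exact ⟨m, e, S, hS.mono hjk, h⟩

/-- The obstructions may be coded with respect to any numbering of the letters. -/
theorem EffClosed.exists_obstructions {X : Set (Config A)} (h : EffClosed k X) {m : ℕ}
    (e : A ≃ Fin m) : ∃ S : List ((ℤ × ℤ) × Fin m) → Prop, IsSigma k S ∧
      ∀ x, x ∈ X ↔ ∀ l, S l → ¬ Matches e l x := by
  obtain ⟨m', e', S, hS, h⟩ := h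
  refine ⟨_, hS.comp (primrec_mapLetters fun c => e' (e.symm c)).to_comp, fun x => ?_⟩
  rw [h]
  constructor
  · intro hx l hl hlx
    refine hx _ hl fun p hp => ?_
    obtain ⟨q, hq, rfl⟩ := List.mem_map.1 hp
    simp [← hlx q hq]
  · intro hx l hl hlx
    refine hx (l.map fun p => (p.1, e (e'.symm p.2))) (by simpa [Function.comp_def] using hl)
      fun p hp => ?_
    obtain ⟨q, hq, rfl⟩ := List.mem_map.1 hp
    simp [← hlx q hq]

theorem EffClosed.finite {X : Set (Config A)} (h : EffClosed k X) : Finite A := by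
  obtain ⟨m, e, -⟩ := h
  exact Finite.of_equiv _ e.symm

theorem EffClosed.isClosed {X : Set (Config A)} (h : EffClosed k X) [TopologicalSpace A]
    [DiscreteTopology A] : IsClosed X := by
  obtain ⟨m, e, S, -, h⟩ := h
  have : X = ⋂ (l) (_ : S l), {x | Matches e l x}ᶜ := by
    ext x; simp [h]
  rw [this]
  exact isClosed_biInter fun l _ => (isClopen_matches e l).isOpen.isClosed_compl

/-- The finite patterns that do not extend to an element of an effectively closed set. -/
theorem EffClosed.isSigma_not_extends {W : Set (Config C)} (hW : EffClosed (k + 1) W)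
    (f : C → Fin m) : IsSigma (k + 1) fun l => ¬ ∃ z ∈ W, Matches f l z := by
  have hfin := hW.finite
  obtain ⟨m', e, S, hS, h⟩ := hW
  -- Over the empty alphabet there is no configuration, so no pattern extends.
  rcases Nat.eq_zero_or_pos m' with rfl | hm
  · refine (isSigma_of_primrec (PrimrecPred.not ?_) _).of_iff (p := fun _ => ¬ False) fun l => ?_
    · exact ⟨inferInstance, Primrec.const _⟩
    · simp only [not_false_iff, true_iff]
      rintro ⟨z, -⟩
      exact (e (z 0)).elim0
  have h1 : PrimrecPred fun y : List ((ℤ × ℤ) × Fin m) × List (List ((ℤ × ℤ) × Fin m')) =>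
      Covers (fun c => f (e.symm c)) y.1 y.2 := primrecRel_covers hm.ne' _
  -- The search is for a finite list `T` of obstructions that covers every configuration compatible
  -- with `l`; compactness ensures that it succeeds whenever `l` does not extend.
  have h2 := ((hS.forall_mem_list.comp Computable.snd).and (isSigma_of_primrec h1 (k + 1))).exists
  refine h2.of_iff fun l => ?_
  constructor
  · rintro ⟨T, hT, hl⟩ ⟨z, hz, hlz⟩
    obtain ⟨t, ht, htz⟩ := hl (fun v => e (z v)) (fun p hp => by simpa using hlz p hp)
    exact (h z).1 hz t (hT t ht) htz
  · intro hl
    obtain ⟨T, hT, hl⟩ := exists_finite_cover f e S l (fun x hx => by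
      by_contra hx'
      push Not at hx'
      exact hl ⟨x, (h x).2 hx', hx⟩)
    refine ⟨T, hT, fun z hz => ?_⟩
    obtain ⟨t, ht, htz⟩ := hl (fun v => e.symm (z v)) hz
    exact ⟨t, ht, fun p hp => by simpa using htz p hp⟩

-- Operations on effectively closed sets, including both quantifiers

theorem EffClosed.inter {X Y : Set (Config A)} (hX : EffClosed k X) (hY : EffClosed k Y) :
    EffClosed k (X ∩ Y) := by
  obtain ⟨m, e, S, hS, h⟩ := hX
  obtain ⟨S', hS', h'⟩ := hY.exists_obstructions e
  refine ⟨m, e, _, hS.or hS', fun x => ?_⟩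
  rw [Set.mem_inter_iff, h, h']
  constructor
  · rintro ⟨h1, h2⟩ l (hl | hl)
    exacts [h1 l hl, h2 l hl]
  · intro h
    exact ⟨fun l hl => h l (Or.inl hl), fun l hl => h l (Or.inr hl)⟩

theorem EffClosed.preimage [Finite C] {X : Set (Config A)} (hX : EffClosed (k + 1) X)
    (π : C → A) : EffClosed (k + 1) {z : Config C | (fun v => π (z v)) ∈ X} := by
  obtain ⟨m, e, S, hS, h⟩ := hX
  obtain ⟨n, ⟨g⟩⟩ := Finite.exists_equiv_fin C
  refine ⟨n, g, _, hS.comp (primrec_mapLetters fun c => e (π (g.symm c))).to_comp, fun z => ?_⟩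
  rw [Set.mem_ofPred_eq, h]
  constructor
  · intro hz l hl hlz
    refine hz _ hl fun p hp => ?_
    obtain ⟨q, hq, rfl⟩ := List.mem_map.1 hp
    simp [← hlz q hq]
  · intro hz l hl hlz
    -- Lifting `l` with the letters of `z` itself guarantees that `π` maps the lift back to `l`.
    refine hz (l.map fun p => (p.1, g (z p.1))) ?_ fun p hp => ?_
    · rw [List.map_map]
      convert hl
      refine (List.map_congr_left fun p hp => ?_).trans (List.map_id l)
      have h1 : e (π (z p.1)) = p.2 := hlz p hp
      simp [h1]
    · obtain ⟨q, hq, rfl⟩ := List.mem_map.1 hp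
      rfl

/-- By compactness of `W`, a configuration lies in the image as soon as each of its finite parts
lifts; the parts without a lift are the obstructions, at the same level. -/
theorem EffClosed.image [Finite U] {W : Set (Config C)} (hW : EffClosed (k + 1) W)
    (π : C → U) : EffClosed (k + 1) {u : Config U | ∃ z ∈ W, ∀ v, π (z v) = u v} := by
  have hfin := hW.finite
  obtain ⟨m, ⟨e⟩⟩ := Finite.exists_equiv_fin U
  refine ⟨m, e, _, hW.isSigma_not_extends fun c => e (π c), fun u => ?_⟩
  constructor
  · rintro ⟨z, hz, hzu⟩ l hl hlu
    exact hl ⟨z, hz, fun p hp => by simp only [hzu, hlu p hp]⟩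
  · intro h
    let _ : TopologicalSpace C := ⊥
    have : DiscreteTopology C := ⟨rfl⟩
    obtain ⟨z, hz, hzu⟩ := hW.isClosed.isCompact.inter_iInter_nonempty
      (fun v : ℤ × ℤ => {z : Config C | π (z v) = u v})
      (fun v => ((isClopen_discrete {c | π c = u v}).preimage (continuous_apply v)).isClosed)
      (fun F => by
        have h1 := mt (h (F.toList.map fun v => (v, e (u v))))
          (not_not.2 fun p hp => by obtain ⟨v, -, rfl⟩ := List.mem_map.1 hp; rfl)
        obtain ⟨z, hz, hzu⟩ := not_not.1 h1
        refine ⟨z, hz, Set.mem_iInter₂.2 fun v hv => ?_⟩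
        have := hzu (v, e (u v)) (List.mem_map.2 ⟨v, Finset.mem_toList.2 hv, rfl⟩)
        exact e.injective this)
    exact ⟨z, hz, fun v => Set.mem_iInter.1 hzu v⟩

/-- Existential quantification over an effectively closed set. -/
theorem EffClosed.exists_mem [Finite A] [Finite U] {Y : Set (Config A)} {Z : Set (Config (U × A))}
    (hY : EffClosed (k + 1) Y) (hZ : EffClosed (k + 1) Z) :
    EffClosed (k + 1) {u : Config U | ∃ y ∈ Y, (fun v => (u v, y v)) ∈ Z} := by
  have h := ((hY.preimage (Prod.snd : U × A → A)).inter hZ).image Prod.fst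
  convert h using 1
  ext u
  constructor
  · rintro ⟨y, hy, hz⟩
    exact ⟨_, ⟨hy, hz⟩, fun _ => rfl⟩
  · rintro ⟨z, ⟨hy, hz⟩, hu⟩
    refine ⟨_, hy, ?_⟩
    convert hz using 2 with v
    exact Prod.ext (hu v).symm rfl

/-- Universal quantification over an effectively closed set. -/
theorem EffClosed.forall_mem [Finite A] [Finite U] {Y : Set (Config A)} {Z : Set (Config (U × A))}
    (hY : EffClosed (k + 1) Y) (hZ : EffClosed (k + 2) Z) :
    EffClosed (k + 2) {u : Config U | ∀ y ∈ Y, (fun v => (u v, y v)) ∈ Z} := by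
  obtain ⟨m, e, S, hS, h⟩ := hZ
  obtain ⟨n, ⟨g⟩⟩ := Finite.exists_equiv_fin U
  obtain ⟨n', ⟨g'⟩⟩ := Finite.exists_equiv_fin A
  -- The obstructions are the `U`-parts of obstructions of `Z` whose `A`-part extends to an element
  -- of `Y`. Extendability is Π at level `k + 1`, hence Σ only at level `k + 2`: this is the single
  -- place where a level is lost.
  have h1 := ((hY.isSigma_not_extends g').not.comp
    ((primrec_mapLetters fun c => g' (e.symm c).2).to_comp.comp
      (Computable.snd (α := List ((ℤ × ℤ) × Fin n))))).isSigma_succ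
  have h2 : PrimrecPred fun y : List ((ℤ × ℤ) × Fin n) × List ((ℤ × ℤ) × Fin m) =>
      y.1 = y.2.map fun p => (p.1, g (e.symm p.2).1) :=
    Primrec.eq.comp Primrec.fst ((primrec_mapLetters fun c => g (e.symm c).1).comp Primrec.snd)
  have h3 := (((hS.comp Computable.snd).and h1).and (isSigma_of_primrec h2 _)).exists
  refine ⟨n, g, _, h3, fun u => ?_⟩
  simp only [not_not, Set.mem_ofPred_eq]
  constructor
  · rintro hu l ⟨t, ⟨ht, y, hy, hty⟩, rfl⟩ hl
    refine (h _).1 (hu y hy) t ht fun p hp => ?_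
    have h1 := hty _ (List.mem_map_of_mem hp)
    have h2 := hl _ (List.mem_map_of_mem hp)
    have h3 : (u p.1, y p.1) = e.symm p.2 :=
      Prod.ext (g.injective h2) (g'.injective h1)
    simp [h3]
  · intro hu y hy
    rw [h]
    intro t ht hty
    refine hu _ ⟨t, ⟨ht, y, hy, fun p hp => ?_⟩, rfl⟩ fun p hp => ?_
    all_goals
      obtain ⟨q, hq, rfl⟩ := List.mem_map.1 hp
      simp [← hty q hq]

/-! ### Comparison with the classes `Π⁰_k` -/

/-- The finite pattern of `x` on the coordinates of the entries of `l`. -/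
def patternOf (l : List ((ℤ × ℤ) × Fin m)) (x : Config A) : FinPattern A :=
  ⟨(l.map Prod.fst).toFinset, fun w => x w⟩

theorem represents_patternOf {e : A ≃ Fin m} {l : List ((ℤ × ℤ) × Fin m)} {x : Config A}
    (h : Matches e l x) : Represents e l (patternOf l x) := by
  intro v c
  constructor
  · intro hv
    exact ⟨by simpa [patternOf] using ⟨c, hv⟩, h _ hv⟩
  · rintro ⟨hv, rfl⟩
    obtain ⟨c, hc⟩ : ∃ c, (v, c) ∈ l := by simpa [patternOf] using hv
    have : e (x v) = c := h _ hc
    simpa [patternOf, this] using hc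

theorem matches_of_occursAt {e : A ≃ Fin m} {l : List ((ℤ × ℤ) × Fin m)} {P : FinPattern A}
    (h : Represents e l P) {x : Config A} {v : ℤ × ℤ} (hx : P.OccursAt x v) :
    Matches e l fun w => x (v + w) := by
  rintro ⟨w, c⟩ hp
  obtain ⟨hw, hc⟩ := (h w c).1 hp
  simp only [← hc]
  rw [hx ⟨w, hw⟩]

/-- Shift invariance moves any occurrence to the origin, which reconciles the translation-invariant
language with anchored obstructions. -/
theorem exists_language_represents {e : A ≃ Fin m} {l : List ((ℤ × ℤ) × Fin m)}
    {X : Set (Config A)} (hX : ShiftInvariant X) :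
    (∃ P ∈ language X, Represents e l P) ↔ ∃ x ∈ X, Matches e l x := by
  constructor
  · rintro ⟨P, ⟨x, hx, v, hv⟩, hP⟩
    exact ⟨_, hX x hx v, matches_of_occursAt hP hv⟩
  · rintro ⟨x, hx, h⟩
    exact ⟨patternOf l x, ⟨x, hx, 0, fun w => by simp [patternOf]⟩, represents_patternOf h⟩

theorem IsSubshift.shiftInvariant {X : Set (Config A)} (h : IsSubshift X) : ShiftInvariant X := by
  obtain ⟨F, rfl⟩ := h
  rintro x hx v P hP ⟨w, hw⟩
  exact hx P hP ⟨v + w, fun u => by rw [← hw u, add_assoc]⟩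

/-- Subshifts are closed: an occurrence of a forbidden pattern is already visible in a finite part
of `x`. -/
theorem IsSubshift.mem_of_forall_matches {X : Set (Config A)} (h : IsSubshift X) (e : A ≃ Fin m)
    {x : Config A} (hx : ∀ l, Matches e l x → ∃ y ∈ X, Matches e l y) : x ∈ X := by
  obtain ⟨F, rfl⟩ := h
  rintro P hP ⟨v, hv⟩
  obtain ⟨y, hy, hl⟩ := hx (P.dom.attach.toList.map fun w : P.dom => (v + (w : ℤ × ℤ), e (P.val w)))
    (fun p hp => by
      obtain ⟨w, -, rfl⟩ := List.mem_map.1 hp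
      exact congrArg e (hv w))
  exact hy P hP ⟨v, fun w => e.injective (hl (v + (w : ℤ × ℤ), e (P.val w))
    (List.mem_map.2 ⟨w, by simp, rfl⟩))⟩

/-- From left to right, the patterns outside the language form a Σ set of obstructions, complete
because `X` is closed. Conversely, forbidding everything outside the language recovers `X`, and by
compactness membership in the language has a Σ complement. -/
theorem mem_arithPi_iff [Finite A] {X : Set (Config A)} :
    X ∈ ArithPi (k + 1) A ↔ ShiftInvariant X ∧ EffClosed (k + 1) X := by
  constructor
  · rintro ⟨hX, m, e, h⟩
    refine ⟨hX.shiftInvariant, m, e, _, h.not, fun x => ?_⟩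
    simp only [exists_language_represents hX.shiftInvariant]
    constructor
    · exact fun hx l hl hlx => hl ⟨x, hx, hlx⟩
    · exact fun hx => hX.mem_of_forall_matches e fun l hl => not_not.1 fun h => hx l h hl
  · rintro ⟨hs, hX⟩
    have hX' := hX
    obtain ⟨m, e, S, hS, h⟩ := hX
    refine ⟨⟨{P | P ∉ language X}, ?_⟩, m, e, ?_⟩
    · ext x
      constructor
      · intro hx P hP hPx
        exact hP ⟨x, hx, hPx⟩
      · intro hx
        rw [h]
        intro l hl hlx
        have h1 : patternOf l x ∈ language X := by
          by_contra h1
          exact hx _ h1 ⟨0, fun w => by simp [patternOf]⟩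
        obtain ⟨y, hy, hly⟩ := (exists_language_represents hs).1
          ⟨_, h1, represents_patternOf hlx⟩
        exact (h y).1 hy l hl hly
    · simp only [exists_language_represents hs]
      exact .of_not (hX'.isSigma_not_extends e)

end EffClosed

/-! ### Effectively closed sets defined by quantifier-free formulas -/

section Formulas

variable {A C : Type} {m r l : ℕ}

theorem Dir.move_eq_add (d : Dir) (v : ℤ × ℤ) : d.move v = v + d.move 0 := by
  cases d <;> ext <;> simp [Dir.move] <;> ring

theorem Term.primrec_eval (t : Term l) : Primrec fun n : Fin l → ℤ × ℤ => t.eval n := by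
  induction t with
  | var i => exact (Primrec.fin_app (σ := ℤ × ℤ)).comp Primrec.id (Primrec.const i)
  | app d t ih =>
    exact (primrec_planeAdd.comp ih (Primrec.const (d.move 0))).of_eq fun n =>
      (d.move_eq_add _).symm

theorem Term.eval_add (t : Term l) (n : Fin l → ℤ × ℤ) (v : ℤ × ℤ) :
    t.eval (fun i => v + n i) = v + t.eval n := by
  induction t with
  | var i => rfl
  | app d t ih =>
    simp only [Term.eval]
    rw [d.move_eq_add, d.move_eq_add (t.eval n), ih, add_assoc]

/-- The property `p` of a configuration and of coordinates holds exactly if a finite part of the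
configuration satisfies a primitive recursive criterion for it. -/
def FinitelyVerified (e : C ≃ Fin m) (p : Config C → (Fin l → ℤ × ℤ) → Prop) : Prop :=
  ∃ P : List ((ℤ × ℤ) × Fin m) × (Fin l → ℤ × ℤ) → Prop, PrimrecPred P ∧
    (∀ z s n, Matches e s z → P (s, n) → p z n) ∧
    ∀ z n, p z n → ∃ s, Matches e s z ∧ ∀ s', s ⊆ s' → P (s', n)

theorem FinitelyVerified.of_iff {e : C ≃ Fin m} {p q : Config C → (Fin l → ℤ × ℤ) → Prop}
    (h : FinitelyVerified e p) (hpq : ∀ z n, p z n ↔ q z n) : FinitelyVerified e q :=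
  (funext₂ fun z n => propext (hpq z n) : p = q) ▸ h

theorem FinitelyVerified.of_coordinates (e : C ≃ Fin m) {p : (Fin l → ℤ × ℤ) → Prop}
    (h : PrimrecPred p) : FinitelyVerified e fun _ n => p n :=
  ⟨fun x => p x.2, h.comp Primrec.snd, fun _ _ _ _ h => h,
    fun _ _ h => ⟨[], fun _ h => by simp at h, fun _ _ => h⟩⟩

theorem FinitelyVerified.of_letter (e : C ≃ Fin m) (t : Term l) (q : C → Prop) :
    FinitelyVerified e fun z n => q (z (t.eval n)) := by
  classical
  have h1 : PrimrecRel fun (p : (ℤ × ℤ) × Fin m) (n : Fin l → ℤ × ℤ) =>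
      p.1 = t.eval n ∧ q (e.symm p.2) :=
    (Primrec.eq.comp (Primrec.fst.comp Primrec.fst) (t.primrec_eval.comp Primrec.snd)).and
      (Primrec.primrecPred ((Primrec.dom_finite fun c => decide (q (e.symm c))).comp
        (Primrec.snd.comp Primrec.fst)))
  refine ⟨_, h1.exists_mem_list, ?_, ?_⟩
  · rintro z s n hs ⟨p, hp, h, hq⟩
    rw [← h]
    rwa [← hs p hp, e.symm_apply_apply] at hq
  · intro z n h
    refine ⟨[(t.eval n, e (z (t.eval n)))], fun p hp => ?_, fun s' hs' => ?_⟩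
    · rw [List.mem_singleton.1 hp]
    · exact ⟨_, hs' (List.mem_singleton_self _), rfl, by simpa using h⟩

/-- Verification survives enlarging the finite part, so the parts verifying the two conjuncts can be
concatenated. -/
theorem FinitelyVerified.and {e : C ≃ Fin m} {p q : Config C → (Fin l → ℤ × ℤ) → Prop}
    (hp : FinitelyVerified e p) (hq : FinitelyVerified e q) :
    FinitelyVerified e fun z n => p z n ∧ q z n := by
  obtain ⟨P, hP, h1, h2⟩ := hp
  obtain ⟨Q, hQ, h3, h4⟩ := hq
  refine ⟨_, hP.and hQ, fun z s n hs h => ⟨h1 z s n hs h.1, h3 z s n hs h.2⟩, ?_⟩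
  rintro z n ⟨hp, hq⟩
  obtain ⟨s, hs, h⟩ := h2 z n hp
  obtain ⟨s', hs', h'⟩ := h4 z n hq
  refine ⟨s ++ s', fun x hx => (List.mem_append.1 hx).elim (hs x) (hs' x), fun t ht => ?_⟩
  exact ⟨h t fun x hx => ht (List.mem_append_left _ hx),
    h' t fun x hx => ht (List.mem_append_right _ hx)⟩

theorem FinitelyVerified.or {e : C ≃ Fin m} {p q : Config C → (Fin l → ℤ × ℤ) → Prop}
    (hp : FinitelyVerified e p) (hq : FinitelyVerified e q) :
    FinitelyVerified e fun z n => p z n ∨ q z n := by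
  obtain ⟨P, hP, h1, h2⟩ := hp
  obtain ⟨Q, hQ, h3, h4⟩ := hq
  refine ⟨_, hP.or hQ, fun z s n hs h => h.imp (h1 z s n hs) (h3 z s n hs), ?_⟩
  rintro z n (h | h)
  · obtain ⟨s, hs, h⟩ := h2 z n h
    exact ⟨s, hs, fun t ht => Or.inl (h t ht)⟩
  · obtain ⟨s, hs, h⟩ := h4 z n h
    exact ⟨s, hs, fun t ht => Or.inr (h t ht)⟩

theorem FinitelyVerified.effClosed {e : C ≃ Fin m} {p : Config C → (Fin l → ℤ × ℤ) → Prop}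
    (h : FinitelyVerified e fun z n => ¬ p z n) : EffClosed 1 {z | ∀ n, p z n} := by
  obtain ⟨P, hP, h1, h2⟩ := h
  refine ⟨m, e, _, (isSigma_of_primrec hP 1).exists, fun z => ?_⟩
  constructor
  · rintro hz s ⟨n, hn⟩ hs
    exact h1 z s n hs hn (hz n)
  · intro hz n
    by_contra hn
    obtain ⟨s, hs, h⟩ := h2 z n hn
    exact hz s ⟨n, h s (List.Subset.refl s)⟩ hs

/-- Finite verifiability is not by itself closed under negation, so the formula and its negation are
treated together, with De Morgan's laws. -/
theorem QFFormula.finitelyVerified {B : Fin r → Type} (e : (A × ∀ i, B i) ≃ Fin m)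
    (φ : QFFormula A B l) :
    (FinitelyVerified e fun z n => φ.Holds (fun v => (z v).1) (fun i v => (z v).2 i) n) ∧
    FinitelyVerified e fun z n => ¬ φ.Holds (fun v => (z v).1) (fun i v => (z v).2 i) n := by
  induction φ with
  | eq t t' =>
    have h : PrimrecPred fun n : Fin l → ℤ × ℤ => t.eval n = t'.eval n :=
      Primrec.eq.comp t.primrec_eval t'.primrec_eval
    exact ⟨.of_coordinates e h, .of_coordinates e h.not⟩
  | symb a t =>
    exact ⟨.of_letter e t fun c => c.1 = a, .of_letter e t fun c => ¬ c.1 = a⟩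
  | conf i b t =>
    exact ⟨.of_letter e t fun c => c.2 i = b, .of_letter e t fun c => ¬ c.2 i = b⟩
  | not φ ih =>
    exact ⟨ih.2, ih.1.of_iff fun z n => not_not.symm⟩
  | and φ ψ ih ih' =>
    exact ⟨ih.1.and ih'.1, (ih.2.or ih'.2).of_iff fun z n => not_and_or.symm⟩
  | or φ ψ ih ih' =>
    exact ⟨ih.1.or ih'.1, (ih.2.and ih'.2).of_iff fun z n => not_or.symm⟩

theorem QFFormula.holds_add {B : Fin r → Type} (φ : QFFormula A B l) (x : Config A)
    (y : ∀ i, Config (B i)) (n : Fin l → ℤ × ℤ) (v : ℤ × ℤ) :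
    φ.Holds (fun w => x (v + w)) (fun i w => y i (v + w)) n ↔
      φ.Holds x y fun i => v + n i := by
  induction φ with
  | eq t t' => simp [QFFormula.Holds, Term.eval_add]
  | symb a t => simp [QFFormula.Holds, Term.eval_add]
  | conf i b t => simp [QFFormula.Holds, Term.eval_add]
  | not φ ih => simp only [QFFormula.Holds, ih]
  | and φ ψ ih ih' => simp only [QFFormula.Holds, ih, ih']
  | or φ ψ ih ih' => simp only [QFFormula.Holds, ih, ih']

/-! ### Quantifier prefixes -/

/-- The outermost variable is moved into the parameter alphabet `U` as an extra track. Each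
quantifier preserves level `k + 2` because its range has level only `k + 1`, so the number of
alternations plays no role. -/
theorem effClosed_prefixHolds {k : ℕ} : ∀ {r : ℕ} (Q : Fin r → Quant) (B : Fin r → Type)
    (_ : ∀ i, Finite (B i)) (X : ∀ i, Set (Config (B i))) (_ : ∀ i, EffClosed (k + 1) (X i))
    {U : Type} [Finite U] (K : Config U → (∀ i, Config (B i)) → Prop)
    (_ : EffClosed (k + 2)
      {z : Config (U × ∀ i, B i) | K (fun v => (z v).1) fun i v => (z v).2 i}),
    EffClosed (k + 2) {u | PrefixHolds Q B X (K u)} := by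
  intro r
  induction r with
  | zero =>
    intro Q B hB X hX U _ K hK
    have h := hK.preimage (fun u : U => ((u, fun i => i.elim0) : U × ∀ i, B i))
    convert h using 3 with u
    simp only [PrefixHolds, Set.mem_ofPred_eq]
    congr! 2 with i
  | succ r ih =>
    intro Q B hB X hX U _ K hK
    have hK' := hK.preimage (fun p : (U × B 0) × (∀ i : Fin r, B i.succ) =>
      ((p.1.1, Fin.cons p.1.2 p.2) : U × ∀ i, B i))
    have h := ih (fun i => Q i.succ) (fun i => B i.succ) (fun i => hB i.succ)
      (fun i => X i.succ) (fun i => hX i.succ)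
      (U := U × B 0) (fun u ys => K (fun v => (u v).1) (Fin.cons (fun v => (u v).2) ys)) (by
        convert hK' using 3 with z
        simp only [Set.mem_ofPred_eq]
        congr! 2 with i
        refine Fin.cases ?_ (fun i => ?_) i <;> rfl)
    cases hQ : Q 0 with
    | all =>
      convert (hX 0).forall_mem h using 3 with u
      simp [PrefixHolds, hQ, Quant.Over]
    | ex =>
      convert ((hX 0).mono (Nat.le_succ _)).exists_mem h using 3 with u
      simp [PrefixHolds, hQ, Quant.Over]

theorem prefixHolds_translate (v : ℤ × ℤ) : ∀ {r : ℕ} (Q : Fin r → Quant) (B : Fin r → Type)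
    (X : ∀ i, Set (Config (B i))) (_ : ∀ i, ShiftInvariant (X i))
    (K K' : (∀ i, Config (B i)) → Prop) (_ : ∀ ys, K ys → K' fun i w => ys i (v + w)),
    PrefixHolds Q B X K → PrefixHolds Q B X K' := by
  intro r
  induction r with
  | zero =>
    intro Q B X hX K K' h hK
    have h1 : (fun i => i.elim0 : ∀ i, Config (B i)) = fun i w => (i.elim0 : Config (B i)) (v + w) :=
      funext fun i => i.elim0
    simp only [PrefixHolds] at hK ⊢
    rw [h1]
    exact h _ hK
  | succ r ih =>
    intro Q B X hX K K' h hK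
    have step : ∀ y y' : Config (B 0), (∀ w, y' w = y (v + w)) →
        PrefixHolds (fun i => Q i.succ) (fun i => B i.succ) (fun i => X i.succ)
          (fun ys => K (Fin.cons y ys)) →
        PrefixHolds (fun i => Q i.succ) (fun i => B i.succ) (fun i => X i.succ)
          (fun ys => K' (Fin.cons y' ys)) := by
      intro y y' hy
      refine ih _ _ _ (fun i => hX i.succ) _ _ fun ys hys => ?_
      convert h _ hys using 1
      funext i
      refine Fin.cases ?_ (fun i => ?_) i
      · exact funext hy
      · rfl
    simp only [PrefixHolds] at hK ⊢
    cases hQ : Q 0 with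
    | all =>
      simp only [hQ, Quant.Over] at hK ⊢
      intro y hy
      -- A universally given `y` is answered by the case of its translate by `-v`.
      exact step (fun w => y (-v + w)) y (fun w => by simp) (hK _ (hX 0 y hy (-v)))
    | ex =>
      simp only [hQ, Quant.Over] at hK ⊢
      obtain ⟨y, hy, h⟩ := hK
      exact ⟨_, hX 0 y hy v, step y _ (fun w => rfl) h⟩

theorem UFormula.models_mem_arithPi [Finite A] {k : ℕ} {ψ : UFormula A}
    (h : ψ.IsOver (ArithPi (k + 1))) : ψ.models ∈ ArithPi (k + 2) A := by
  have hfin := ψ.finite_alph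
  have h' := fun i => (mem_arithPi_iff (A := ψ.alph i)).1 (h i)
  refine mem_arithPi_iff.2 ⟨?_, ?_⟩
  · intro x hx v
    refine prefixHolds_translate v _ _ _ (fun i => (h' i).1) _ _ ?_ hx
    intro ys hys n
    rw [QFFormula.holds_add]
    exact hys _
  · refine effClosed_prefixHolds _ _ hfin _ (fun i => (h' i).2)
      (fun x y => ∀ n : Fin ψ.l → ℤ × ℤ, ψ.body.Holds x y n) ?_
    obtain ⟨m, ⟨e⟩⟩ := Finite.exists_equiv_fin (A × ∀ i, ψ.alph i)
    exact (ψ.body.finitelyVerified e).2.effClosed.mono (by omega)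

theorem piBar_subset_arithPi {k n : ℕ} [Finite A] :
    PiBar n (ArithPi (k + 1)) A ⊆ ArithPi (k + 2) A := by
  rintro _ ⟨ψ, h, -, rfl⟩
  exact ψ.models_mem_arithPi h

end Formulas

/-! ### Subshifts of finite type -/

section SFT

variable {A : Type}

/-- The obstructions are all translates of the finitely many forbidden patterns. -/
theorem sft_subset_arithPi_one [Finite A] : SFT A ⊆ ArithPi 1 A := by
  rintro _ ⟨F, hF, rfl⟩
  refine mem_arithPi_iff.2 ⟨IsSubshift.shiftInvariant ⟨F, rfl⟩, ?_⟩
  obtain ⟨m, ⟨e⟩⟩ := Finite.exists_equiv_fin A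
  let code : FinPattern A → List ((ℤ × ℤ) × Fin m) := fun P =>
    P.dom.attach.toList.map fun w : P.dom => ((w : ℤ × ℤ), e (P.val w))
  have hcode : ∀ (P : FinPattern A) (x : Config A) (v : ℤ × ℤ),
      P.OccursAt x v ↔ Matches e ((code P).map fun p => (v + p.1, p.2)) x := by
    intro P x v
    constructor
    · rintro h p hp
      obtain ⟨q, hq, rfl⟩ := List.mem_map.1 hp
      obtain ⟨w, -, rfl⟩ := List.mem_map.1 hq
      exact congrArg e (h w)
    · intro h w
      exact e.injective (h (v + (w : ℤ × ℤ), e (P.val w))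
        (List.mem_map.2 ⟨_, List.mem_map.2 ⟨w, by simp, rfl⟩, rfl⟩))
  have h1 : PrimrecRel fun (s : List ((ℤ × ℤ) × Fin m))
      (y : List ((ℤ × ℤ) × Fin m) × (ℤ × ℤ)) => y.1 = s.map fun p => (y.2 + p.1, p.2) :=
    Primrec.eq.comp (Primrec.fst.comp Primrec.snd) (Primrec.list_map Primrec.fst
      (Primrec.pair (primrec_planeAdd.comp (Primrec.snd.comp (Primrec.snd.comp Primrec.fst))
        (Primrec.fst.comp Primrec.snd)) (Primrec.snd.comp Primrec.snd)).to₂)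
  have h2 := h1.exists_mem_list.comp (Primrec.const (hF.toFinset.toList.map code)) Primrec.id
  refine ⟨m, e, _, (isSigma_of_primrec h2 1).exists, fun x => ?_⟩
  constructor
  · rintro hx s ⟨v, t, ht, hst⟩ hs
    change s = t.map fun p => (v + p.1, p.2) at hst
    subst hst
    obtain ⟨P, hP, rfl⟩ := List.mem_map.1 ht
    exact hx P (by simpa using hP) ⟨v, (hcode P x v).2 hs⟩
  · rintro hx P hP ⟨v, hv⟩
    exact hx _ ⟨v, code P, List.mem_map_of_mem (by simpa using hP), rfl⟩ ((hcode P x v).1 hv)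

theorem PiBar.mono {C D : ShiftClass} (h : ∀ (A : Type) [Finite A], C A ⊆ D A) (n : ℕ)
    [Finite A] : PiBar n C A ⊆ PiBar n D A := by
  rintro _ ⟨ψ, hψ, hn, rfl⟩
  exact ⟨ψ, fun i => @h _ (ψ.finite_alph i) _ (hψ i), hn, rfl⟩

end SFT

/-! ### Finite patterns described by walks -/

/-- A finite-state device that turns a word of bits into a walk on the plane, along which letters
are read. -/
structure Walker (m N : ℕ) where
  next : Fin (N + 1) → Bool → Fin (N + 1)
  disp : Fin (N + 1) → Bool → ℤ × ℤ
  read : Fin (N + 1) → Bool → Option (Fin m)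
  count : Fin (N + 1) → Bool → ℕ

namespace Walker

variable {m N : ℕ} (W : Walker m N)

/-- One step of the walk; the components are the state, the position, the entries read so far, and
a counter. -/
def step (st : (Fin (N + 1) × (ℤ × ℤ)) × (List ((ℤ × ℤ) × Fin m) × ℕ)) (b : Bool) :
    (Fin (N + 1) × (ℤ × ℤ)) × (List ((ℤ × ℤ) × Fin m) × ℕ) :=
  ((W.next st.1.1 b, st.1.2 + W.disp st.1.1 b),
    (st.2.1 ++ (W.read st.1.1 b).toList.map (fun c => (st.1.2, c)), st.2.2 + W.count st.1.1 b))

/-- The result of the walk along `w`. -/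
def run (w : List Bool) : (Fin (N + 1) × (ℤ × ℤ)) × (List ((ℤ × ℤ) × Fin m) × ℕ) :=
  w.foldl W.step ((0, 0), ([], 0))

def state (w : List Bool) : Fin (N + 1) := (W.run w).1.1

def pos (w : List Bool) : ℤ × ℤ := (W.run w).1.2

def entries (w : List Bool) : List ((ℤ × ℤ) × Fin m) := (W.run w).2.1

theorem run_concat (w : List Bool) (b : Bool) : W.run (w ++ [b]) = W.step (W.run w) b := by
  simp [run]

theorem state_concat (w : List Bool) (b : Bool) :
    W.state (w ++ [b]) = W.next (W.state w) b := by
  simp [state, run_concat, step]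

theorem pos_concat (w : List Bool) (b : Bool) :
    W.pos (w ++ [b]) = W.pos w + W.disp (W.state w) b := by
  simp [state, pos, run_concat, step]

theorem state_take_succ (w : List Bool) (t : ℕ) (ht : t < w.length) :
    W.state (w.take (t + 1)) = W.next (W.state (w.take t)) w[t] := by
  rw [← state_concat, List.take_concat_get']

theorem pos_take_succ (w : List Bool) (t : ℕ) (ht : t < w.length) :
    W.pos (w.take (t + 1)) = W.pos (w.take t) + W.disp (W.state (w.take t)) w[t] := by
  rw [← pos_concat, List.take_concat_get']

theorem mem_entries {w : List Bool} {p : (ℤ × ℤ) × Fin m} :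
    p ∈ W.entries w ↔ ∃ (t : ℕ) (ht : t < w.length),
      W.read (W.state (w.take t)) w[t] = some p.2 ∧ W.pos (w.take t) = p.1 := by
  induction w using List.reverseRecOn with
  | nil => simp [entries, run]
  | append_singleton w b ih =>
    have h1 : W.entries (w ++ [b]) =
        W.entries w ++ (W.read (W.state w) b).toList.map (fun c => (W.pos w, c)) := by
      simp [entries, state, pos, run_concat, step]
    rw [h1, List.mem_append, ih]
    constructor
    · rintro (⟨t, ht, h⟩ | h)
      · refine ⟨t, by simp; omega, ?_⟩
        rwa [List.take_append_of_le_length ht.le, List.getElem_append_left ht]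
      · obtain ⟨c, hc, rfl⟩ := List.mem_map.1 h
        refine ⟨w.length, by simp, ?_⟩
        simpa using hc
    · rintro ⟨t, ht, h⟩
      rcases Nat.lt_or_ge t w.length with ht' | ht'
      · left
        refine ⟨t, ht', ?_⟩
        rwa [List.take_append_of_le_length ht'.le, List.getElem_append_left ht'] at h
      · right
        obtain rfl : t = w.length := by simp at ht; omega
        simp only [List.take_left', List.getElem_concat_length] at h
        exact List.mem_map.2 ⟨p.2, by simpa using h.1, Prod.ext h.2 rfl⟩

theorem primrec_run : Primrec W.run := by
  have hs : ∀ {σ : Type} [Primcodable σ] (f : Fin (N + 1) → Bool → σ),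
      Primrec fun x : List Bool × ((Fin (N + 1) × (ℤ × ℤ)) × (List ((ℤ × ℤ) × Fin m) × ℕ)) × Bool =>
        f x.2.1.1.1 x.2.2 := fun f =>
    (Primrec.dom_finite fun y : Fin (N + 1) × Bool => f y.1 y.2).comp
      (Primrec.pair (Primrec.fst.comp (Primrec.fst.comp (Primrec.fst.comp Primrec.snd)))
        (Primrec.snd.comp Primrec.snd))
  have hp : Primrec fun x : List Bool ×
      ((Fin (N + 1) × (ℤ × ℤ)) × (List ((ℤ × ℤ) × Fin m) × ℕ)) × Bool => x.2.1.1.2 :=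
    Primrec.snd.comp (Primrec.fst.comp (Primrec.fst.comp Primrec.snd))
  have he : Primrec fun x : List Bool ×
      ((Fin (N + 1) × (ℤ × ℤ)) × (List ((ℤ × ℤ) × Fin m) × ℕ)) × Bool => x.2.1.2 :=
    Primrec.snd.comp (Primrec.fst.comp Primrec.snd)
  have hr : Primrec fun x : List Bool ×
      ((Fin (N + 1) × (ℤ × ℤ)) × (List ((ℤ × ℤ) × Fin m) × ℕ)) × Bool =>
      (W.read x.2.1.1.1 x.2.2).toList.map fun c => (x.2.1.1.2, c) :=
    Primrec.list_map (Primrec.optionToList.comp (hs W.read))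
      (Primrec.pair (hp.comp Primrec.fst) Primrec.snd).to₂
  have hstep : Primrec₂ fun (_ : List Bool)
      (x : ((Fin (N + 1) × (ℤ × ℤ)) × (List ((ℤ × ℤ) × Fin m) × ℕ)) × Bool) => W.step x.1 x.2 :=
    Primrec.pair (Primrec.pair (hs W.next) (primrec_planeAdd.comp hp (hs W.disp)))
      (Primrec.pair (Primrec.list_append.comp (Primrec.fst.comp he) hr)
        (Primrec.nat_add.comp (Primrec.snd.comp he) (hs W.count)))
  exact Primrec.list_foldl Primrec.id (Primrec.const ((0, 0), ([], 0))) hstep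

theorem primrec_state : Primrec W.state :=
  Primrec.fst.comp (Primrec.fst.comp W.primrec_run)

end Walker

/-- The unit displacement with number `s`. -/
def unitDisp (s : ℕ) : ℤ × ℤ :=
  if s = 1 then (1, 0) else if s = 2 then (-1, 0) else if s = 3 then (0, 1) else
    if s = 4 then (0, -1) else 0

/-- The walker that counts consecutive ones in its state, and executes the instruction whose number
has been counted when it meets a zero. -/
def unaryWalker (m : ℕ) : Walker m (m + 4) where
  next s b := if b then (if h : s.1 + 1 < m + 5 then ⟨s.1 + 1, h⟩ else s) else 0
  disp s b := if b then 0 else unitDisp s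
  read s b := if b then none else if h : 5 ≤ s.1 then some ⟨s.1 - 5, by omega⟩ else none
  count s b := if b then 0 else if s.1 = 0 then 1 else 0

section UnaryWalker

variable {m : ℕ}

theorem unaryWalker_foldl_ones (s : ℕ) (hs : s < m + 5) (d : ℤ × ℤ)
    (x : List ((ℤ × ℤ) × Fin m) × ℕ) :
    (List.replicate s true).foldl (unaryWalker m).step ((0, d), x) = ((⟨s, hs⟩, d), x) := by
  induction s with
  | zero => rfl
  | succ s ih =>
    rw [List.replicate_succ', List.foldl_append, ih (by omega)]
    have hs' : s < m + 4 := by omega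
    simp [Walker.step, unaryWalker, hs']

/-- The walker can get from the situation `y` to the situation `z`, in the initial state. -/
def WalksTo (y z : (ℤ × ℤ) × (List ((ℤ × ℤ) × Fin m) × ℕ)) : Prop :=
  ∃ w : List Bool, w.foldl (unaryWalker m).step ((0, y.1), y.2) = ((0, z.1), z.2)

theorem WalksTo.trans {x y z : (ℤ × ℤ) × (List ((ℤ × ℤ) × Fin m) × ℕ)} (h : WalksTo x y)
    (h' : WalksTo y z) : WalksTo x z := by
  obtain ⟨w, h⟩ := h
  obtain ⟨w', h'⟩ := h'
  exact ⟨w ++ w', by rw [List.foldl_append, h, h']⟩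

/-- Instruction `s` is written as `s` ones and a zero: `0` increments the counter, `1` to `4` are
unit moves, and `5 + c` reads the letter `c` in place. -/
theorem walksTo_instruction (s : ℕ) (hs : s < m + 5) (d : ℤ × ℤ)
    (l : List ((ℤ × ℤ) × Fin m)) (M : ℕ) :
    WalksTo (d, l, M) (d + unitDisp s, l ++ ((unaryWalker m).read ⟨s, hs⟩ false).toList.map
      (fun c => (d, c)), M + if s = 0 then 1 else 0) := by
  refine ⟨List.replicate s true ++ [false], ?_⟩
  rw [List.foldl_append, unaryWalker_foldl_ones s hs]
  rfl

theorem walksTo_move_nsmul (s : ℕ) (h1 : 1 ≤ s) (h2 : s ≤ 4) (n : ℕ) (d : ℤ × ℤ)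
    (x : List ((ℤ × ℤ) × Fin m) × ℕ) : WalksTo (d, x) (d + n • unitDisp s, x) := by
  induction n with
  | zero => exact ⟨[], by simp⟩
  | succ n ih =>
    refine ih.trans ?_
    have h := walksTo_instruction s (by omega) (d + n • unitDisp s) x.1 x.2
    have h3 : ¬ 5 ≤ s := by omega
    have h4 : s ≠ 0 := by omega
    rw [succ_nsmul, ← add_assoc]
    simpa [unaryWalker, h3, h4] using h

theorem walksTo_move (d d' : ℤ × ℤ) (x : List ((ℤ × ℤ) × Fin m) × ℕ) :
    WalksTo (d, x) (d', x) := by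
  have h := (((walksTo_move_nsmul 1 (by omega) (by omega) (d'.1 - d.1).toNat d x).trans
    (walksTo_move_nsmul 2 (by omega) (by omega) (d.1 - d'.1).toNat _ x)).trans
    (walksTo_move_nsmul 3 (by omega) (by omega) (d'.2 - d.2).toNat _ x)).trans
    (walksTo_move_nsmul 4 (by omega) (by omega) (d.2 - d'.2).toNat _ x)
  convert h using 2
  ext <;> simp [unitDisp] <;> omega

/-- The program first sets the counter to `M`, then visits the coordinate of each entry, reads its
letter and returns to the origin. -/
theorem exists_unaryWalker_run (l : List ((ℤ × ℤ) × Fin m)) (M : ℕ) :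
    ∃ w, (unaryWalker m).entries w = l ∧ ((unaryWalker m).run w).2.2 = M := by
  have h1 : WalksTo (m := m) (0, [], 0) (0, [], M) := by
    induction M with
    | zero => exact ⟨[], rfl⟩
    | succ M ih =>
      refine ih.trans ?_
      simpa [unaryWalker, unitDisp] using walksTo_instruction (m := m) 0 (by omega) 0 [] M
  have h2 : WalksTo (m := m) (0, [], 0) (0, l, M) := by
    induction l using List.reverseRecOn with
    | nil => exact h1
    | append_singleton l p ih =>
      refine (ih.trans (walksTo_move 0 p.1 _)).trans
        (WalksTo.trans ?_ (walksTo_move p.1 0 _))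
      have h := walksTo_instruction (5 + p.2.1) (by omega) p.1 l M
      have h3 : unitDisp (5 + p.2.1) = 0 := by
        unfold unitDisp
        rw [if_neg (by omega), if_neg (by omega), if_neg (by omega), if_neg (by omega)]
      simpa [unaryWalker, h3] using h
  obtain ⟨w, hw⟩ := h2
  have hw' : (unaryWalker m).run w = ((0, 0), (l, M)) := hw
  exact ⟨w, by simp [Walker.entries, hw'], by rw [hw']⟩

end UnaryWalker

/-- A `Π⁰_(k+2)` subshift is described by a `Π⁰_(k+1)` set of forbidden walks. -/
theorem exists_forbidden_walks {A : Type} [Finite A] {k m : ℕ} {X : Set (Config A)}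
    (hX : X ∈ ArithPi (k + 2) A) (e : A ≃ Fin m) :
    ∃ G : List Bool → Prop, IsPi (k + 1) G ∧ ∀ x, x ∈ X ↔
      ∀ w, G w → ∀ v, ¬ Matches e ((unaryWalker m).entries w) fun u => x (v + u) := by
  obtain ⟨hs, hX⟩ := mem_arithPi_iff.1 hX
  obtain ⟨S, hS, h⟩ := hX.exists_obstructions e
  obtain ⟨q, hq, hSq⟩ := isSigma_succ.1 hS
  -- A word carries an obstruction in its entries and the witness of the outer existential
  -- quantifier in its counter. With that quantifier absorbed, the condition on words drops to Π at
  -- level `k + 1`.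
  refine ⟨_, hq.comp (Primrec.snd.comp (unaryWalker m).primrec_run).to_comp, fun x => ?_⟩
  constructor
  · intro hx w hw v
    exact (h _).1 (hs x hx v) _ ((hSq _).2 ⟨_, hw⟩)
  · intro hx
    rw [h]
    intro l hl hlx
    obtain ⟨M, hM⟩ := (hSq l).1 hl
    obtain ⟨w, rfl, rfl⟩ := exists_unaryWalker_run l M
    exact hx w hM 0 (by simpa using hlx)

/-! ### Definability of local properties -/

section Local

theorem Dir.exists_term {l : ℕ} (i : Fin l) (d : ℤ × ℤ) :
    ∃ t : Term l, ∀ n, t.eval n = n i + d := by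
  have h1 : ∀ a : ℤ, ∃ t : Term l, ∀ n, t.eval n = n i + (a, 0) := by
    intro a
    induction a with
    | zero => exact ⟨.var i, fun n => by simp [Term.eval]⟩
    | succ a ih =>
      obtain ⟨t, ht⟩ := ih
      exact ⟨.app .east t, fun n => by ext <;> simp [Term.eval, Dir.move, ht, add_assoc]⟩
    | pred a ih =>
      obtain ⟨t, ht⟩ := ih
      exact ⟨.app .west t, fun n => by
        ext <;> simp [Term.eval, Dir.move, ht, add_assoc, sub_eq_add_neg]⟩
  have h2 : ∀ b : ℤ, ∃ t : Term l, ∀ n, t.eval n = n i + (d.1, b) := by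
    intro b
    induction b with
    | zero => exact h1 d.1
    | succ b ih =>
      obtain ⟨t, ht⟩ := ih
      exact ⟨.app .north t, fun n => by ext <;> simp [Term.eval, Dir.move, ht, add_assoc]⟩
    | pred b ih =>
      obtain ⟨t, ht⟩ := ih
      exact ⟨.app .south t, fun n => by
        ext <;> simp [Term.eval, Dir.move, ht, add_assoc, sub_eq_add_neg]⟩
  exact h2 d.2

variable {A : Type} {r l : ℕ} {B : Fin r → Type}

/-- The property `p` is expressed by a quantifier-free formula. -/
def Definable (p : Config A → (∀ i, Config (B i)) → (Fin l → ℤ × ℤ) → Prop) : Prop :=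
  ∃ φ : QFFormula A B l, ∀ x y n, φ.Holds x y n ↔ p x y n

theorem Definable.and {p q : Config A → (∀ i, Config (B i)) → (Fin l → ℤ × ℤ) → Prop}
    (hp : Definable p) (hq : Definable q) : Definable fun x y n => p x y n ∧ q x y n := by
  obtain ⟨φ, hφ⟩ := hp
  obtain ⟨ψ, hψ⟩ := hq
  exact ⟨.and φ ψ, fun x y n => and_congr (hφ x y n) (hψ x y n)⟩

theorem Definable.or {p q : Config A → (∀ i, Config (B i)) → (Fin l → ℤ × ℤ) → Prop}
    (hp : Definable p) (hq : Definable q) : Definable fun x y n => p x y n ∨ q x y n := by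
  obtain ⟨φ, hφ⟩ := hp
  obtain ⟨ψ, hψ⟩ := hq
  exact ⟨.or φ ψ, fun x y n => or_congr (hφ x y n) (hψ x y n)⟩

theorem Definable.not {p : Config A → (∀ i, Config (B i)) → (Fin l → ℤ × ℤ) → Prop}
    (hp : Definable p) : Definable fun x y n => ¬ p x y n := by
  obtain ⟨φ, hφ⟩ := hp
  exact ⟨.not φ, fun x y n => not_congr (hφ x y n)⟩

theorem Definable.false (i : Fin l) :
    Definable fun (_ : Config A) (_ : ∀ i, Config (B i)) (_ : Fin l → ℤ × ℤ) => False :=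
  ⟨.not (.eq (.var i) (.var i)), fun _ _ _ => by simp [QFFormula.Holds]⟩

theorem Definable.exists_mem_list {ι : Type} (i : Fin l) (L : List ι)
    {p : ι → Config A → (∀ i, Config (B i)) → (Fin l → ℤ × ℤ) → Prop}
    (h : ∀ a, Definable (p a)) : Definable fun x y n => ∃ a ∈ L, p a x y n := by
  induction L with
  | nil => simpa using Definable.false i
  | cons a L ih => simpa using (h a).or ih

theorem Definable.exists {ι : Type} [Finite ι] (i : Fin l)
    {p : ι → Config A → (∀ i, Config (B i)) → (Fin l → ℤ × ℤ) → Prop}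
    (h : ∀ a, Definable (p a)) : Definable fun x y n => ∃ a, p a x y n := by
  have := Fintype.ofFinite ι
  simpa using Definable.exists_mem_list i (Finset.univ : Finset ι).toList h

theorem Definable.forall {ι : Type} [Finite ι] (i : Fin l)
    {p : ι → Config A → (∀ i, Config (B i)) → (Fin l → ℤ × ℤ) → Prop}
    (h : ∀ a, Definable (p a)) : Definable fun x y n => ∀ a, p a x y n := by
  simpa using (Definable.exists i fun a => (h a).not).not

/-- A property that depends only on the letters at finitely many offsets from the given
coordinates is definable. -/
theorem Definable.of_local [Finite A] [∀ i, Finite (B i)] (i : Fin l) {D : Set (ℤ × ℤ)}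
    (hD : D.Finite) {p : Config A → (∀ i, Config (B i)) → (Fin l → ℤ × ℤ) → Prop}
    (h : ∀ x y n x' y' n', (∀ j, ∀ d ∈ D, x (n j + d) = x' (n' j + d)) →
      (∀ i j, ∀ d ∈ D, y i (n j + d) = y' i (n' j + d)) → p x y n → p x' y' n') :
    Definable p := by
  have := hD.to_subtype
  -- The formula is the disjunction over those of the finitely many windows that occur in some
  -- situation satisfying `p`.
  let Win := (Fin l → D → A) × (∀ i, Fin l → D → B i)
  have h1 : ∀ f : {f : Win // ∃ x y n, p x y n ∧ (∀ j (d : D), x (n j + d) = f.1 j d) ∧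
      ∀ i j (d : D), y i (n j + d) = f.2 i j d},
      Definable (A := A) (B := B) (l := l) fun x y n =>
        (∀ j (d : D), x (n j + d) = f.1.1 j d) ∧ ∀ i j (d : D), y i (n j + d) = f.1.2 i j d := by
    intro f
    refine Definable.and ?_ ?_
    · refine .forall i fun j => .forall i fun d => ?_
      obtain ⟨t, ht⟩ := Dir.exists_term j d
      exact ⟨.symb (f.1.1 j d) t, fun x y n => by simp [QFFormula.Holds, ht]⟩
    · refine .forall i fun i' => .forall i fun j => .forall i fun d => ?_
      obtain ⟨t, ht⟩ := Dir.exists_term j d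
      exact ⟨.conf i' (f.1.2 i' j d) t, fun x y n => by simp [QFFormula.Holds, ht]⟩
  obtain ⟨φ, hφ⟩ := Definable.exists i h1
  refine ⟨φ, fun x y n => (hφ x y n).trans ?_⟩
  constructor
  · rintro ⟨⟨f, x', y', n', hp, h2, h3⟩, h4, h5⟩
    refine h x' y' n' x y n (fun j d hd => ?_) (fun i j d hd => ?_) hp
    · exact (h2 j ⟨d, hd⟩).trans (h4 j ⟨d, hd⟩).symm
    · exact (h3 i j ⟨d, hd⟩).trans (h5 i j ⟨d, hd⟩).symm
  · intro hp
    exact ⟨⟨(fun j d => x (n j + d), fun i j d => y i (n j + d)), x, y, n, hp,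
      fun _ _ => rfl, fun _ _ _ => rfl⟩, fun _ _ => rfl, fun _ _ _ => rfl⟩

/-- The configurations all of whose windows satisfy a local property form a subshift of finite
type. -/
theorem mem_sft_of_local [Finite A] {D : Set (ℤ × ℤ)} (hD : D.Finite) {p : Config A → Prop}
    (h : ∀ y y', (∀ d ∈ D, y d = y' d) → p y → p y') :
    {y : Config A | ∀ v, p fun w => y (v + w)} ∈ SFT A := by
  -- The forbidden patterns are the windows on `D` none of whose extensions satisfies `p`.
  let pat : (hD.toFinset → A) → FinPattern A := fun f => ⟨hD.toFinset, f⟩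
  refine ⟨pat '' {f | ∀ y : Config A, (∀ d : hD.toFinset, y d = f d) → ¬ p y},
    (Set.toFinite _).image _, ?_⟩
  ext y
  constructor
  · rintro hy _ ⟨f, hf, rfl⟩ ⟨v, hv⟩
    exact hf (fun w => y (v + w)) (fun d => hv d) (hy v)
  · intro hy v
    by_contra hv
    refine hy (pat fun d => y (v + d)) ⟨_, fun y' hy' hp => hv (h y' _ (fun d hd => ?_) hp), rfl⟩
      ⟨v, fun d => rfl⟩
    exact hy' ⟨d, by simpa using hd⟩

end Local

/-! ### Alternating prefixes -/

section Alternation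

/-- The alternating sequence of quantifiers that starts with a universal one. -/
def altQuant (i : ℕ) : Quant := if i % 2 = 0 then .all else .ex

theorem altQuant_succ_ne (i : ℕ) : altQuant i ≠ altQuant (i + 1) := by
  unfold altQuant
  rcases Nat.mod_two_eq_zero_or_one i with h | h
  · rw [if_pos h, if_neg (by omega)]; exact fun h => Quant.noConfusion h
  · rw [if_neg (by omega), if_pos (by omega)]; exact fun h => Quant.noConfusion h

theorem blockCount_altQuant (r s : ℕ) :
    blockCount (List.ofFn fun i : Fin r => altQuant (s + i)) = r := by
  induction r generalizing s with
  | zero => rfl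
  | succ r ih =>
    cases r with
    | zero => rfl
    | succ r =>
      have h := ih (s + 1)
      rw [List.ofFn_succ] at h
      rw [List.ofFn_succ, List.ofFn_succ, blockCount, if_neg (by exact altQuant_succ_ne s)]
      simp only [Fin.val_succ, Fin.val_zero, Nat.add_zero, Nat.add_assoc, Nat.add_comm 1] at h ⊢
      rw [h]

/-- Dummy quantifiers over nonempty ranges change nothing, so the prefix can be padded to any number
of blocks. -/
theorem prefixHolds_const : ∀ {r : ℕ} (Q : Fin r → Quant) (B : Fin r → Type)
    (X : ∀ i, Set (Config (B i))) (_ : ∀ i, (X i).Nonempty) (P : Prop),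
    PrefixHolds Q B X (fun _ => P) ↔ P := by
  intro r
  induction r with
  | zero => intro Q B X hX P; simp [PrefixHolds]
  | succ r ih =>
    intro Q B X hX P
    have h := ih (fun i => Q i.succ) (fun i => B i.succ) (fun i => X i.succ)
      (fun i => hX i.succ) P
    simp only [PrefixHolds]
    obtain ⟨y, hy⟩ := hX 0
    cases Q 0 with
    | all => exact ⟨fun h' => h.1 (h' y hy), fun hp _ _ => h.2 hp⟩
    | ex => exact ⟨fun ⟨_, _, h'⟩ => h.1 h', fun hp => ⟨y, hy, h.2 hp⟩⟩

/-- The alphabets `B`, `Z`, and then one-letter alphabets. -/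
def paddedAlph (B Z : Type) (n : ℕ) : Fin (n + 2) → Type :=
  Fin.cons B (Fin.cons Z fun _ => Unit)

theorem finite_paddedAlph (B Z : Type) [Finite B] [Finite Z] (n : ℕ) :
    ∀ i, Finite (paddedAlph B Z n i) :=
  Fin.cases ‹Finite B› (Fin.cases ‹Finite Z› fun _ => inferInstanceAs (Finite Unit))

/-- A property of the form `∀ y ∈ Y, ∃ z, ∀ n₀ n₁, p`, where `p` is local, is definable with any
number `n + 2` of quantifier blocks. -/
theorem mem_piBar_of_local {C : ShiftClass} (hC : ∀ (B : Type) [Finite B], Set.univ ∈ C B)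
    {A B Z : Type} [Finite A] [Finite B] [Finite Z] {Y : Set (Config B)} (hY : Y ∈ C B)
    {D : Set (ℤ × ℤ)} (hD : D.Finite)
    {p : Config A → Config B → Config Z → (Fin 2 → ℤ × ℤ) → Prop}
    (hp : ∀ x y z n x' y' z' n', (∀ j, ∀ d ∈ D, x (n j + d) = x' (n' j + d)) →
      (∀ j, ∀ d ∈ D, y (n j + d) = y' (n' j + d)) →
      (∀ j, ∀ d ∈ D, z (n j + d) = z' (n' j + d)) → p x y z n → p x' y' z' n') (n : ℕ) :
    {x : Config A | ∀ y ∈ Y, ∃ z, ∀ v, p x y z v} ∈ PiBar (n + 2) C A := by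
  have hfin := finite_paddedAlph B Z n
  obtain ⟨φ, hφ⟩ := Definable.of_local (A := A) (B := paddedAlph B Z n) (l := 2) 0 hD
    (p := fun x y v => p x (y 0) (y 1) v) (fun x y v x' y' v' h1 h2 =>
      hp _ _ _ _ _ _ _ _ h1 (h2 0) (h2 1))
  -- Each block is a single quantifier: `∀` over `Y`, `∃` over the full shift on `Z`, then `n`
  -- alternating dummies over one-letter full shifts.
  refine ⟨⟨n + 2, fun i => altQuant i, paddedAlph B Z n, hfin,
    Fin.cons Y fun _ => Set.univ, 2, φ⟩, ?_, ⟨?_, ?_⟩, ?_⟩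
  · refine Fin.cases hY fun i => ?_
    exact @hC _ (hfin i.succ)
  · simpa using blockCount_altQuant (n + 2) 0
  · intro Q hQ
    rw [List.ofFn_succ] at hQ
    simpa [altQuant, eq_comm] using hQ
  · ext x
    simp only [UFormula.models, UFormula.Models, PrefixHolds, hφ]
    refine forall₂_congr fun y hy => ?_
    constructor
    · rintro ⟨z, hz⟩
      refine ⟨z, Set.mem_univ _, ?_⟩
      refine (prefixHolds_const _ _ _ (fun i => ?_) (∀ v, p x y z v)).2 hz
      exact ⟨fun _ => (), Set.mem_univ _⟩
    · rintro ⟨z, -, hz⟩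
      refine ⟨z, (prefixHolds_const _ _ _ (fun i => ?_) (∀ v, p x y z v)).1 hz⟩
      exact ⟨fun _ => (), Set.mem_univ _⟩

end Alternation

/-! ### Layout of a bit word on the plane -/

/-- Labels of columns: an origin column and a marked column are followed by columns that carry the
bits of a word and the state of a walker, and then by blank columns. -/
inductive ColLabel (N : ℕ)
  | left | origin | one | bit (s : Fin (N + 1)) (b : Bool) | blank

/-- Labels of rows: the rows below, at, and above the origin row. -/
inductive RowLabel
  | below | zero | above

instance (N : ℕ) : Finite (ColLabel N) := by
  let f : ColLabel N → Option (Option (Option (Option (Fin (N + 1) × Bool))))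
    | .left => none
    | .origin => some none
    | .one => some (some none)
    | .blank => some (some (some none))
    | .bit s b => some (some (some (some (s, b))))
  refine Finite.of_injective f fun a b h => ?_
  cases a <;> cases b <;> simp_all [f]

instance : Finite RowLabel := by
  let f : RowLabel → Option Bool
    | .below => none
    | .zero => some false
    | .above => some true
  refine Finite.of_injective f fun a b h => ?_
  cases a <;> cases b <;> simp_all [f]

namespace Walker

variable {m N : ℕ} (W : Walker m N)

/-- The label of the column `i` in the layout of `w` with origin column `0`. -/
def colLabel (w : List Bool) (i : ℤ) : ColLabel N :=
  if i < 0 then .left else if i = 0 then .origin else if i = 1 then .one else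
    if h : (i - 2).toNat < w.length then
      .bit (W.state (w.take (i - 2).toNat)) w[(i - 2).toNat] else .blank

/-- The label of the row `j` in a layout with origin row `0`. -/
def _root_.MSOShift.rowLabel (j : ℤ) : RowLabel :=
  if j < 0 then .below else if j = 0 then .zero else .above

/-- The labelling `lab` is the layout of `w` with origin `v`. -/
def IsLayout (w : List Bool) (v : ℤ × ℤ) (lab : Config (ColLabel N × RowLabel)) : Prop :=
  ∀ i j : ℤ, lab (v + (i, j)) = (W.colLabel w i, rowLabel j)

theorem colLabel_eq_origin {w : List Bool} {i : ℤ} : W.colLabel w i = .origin ↔ i = 0 := by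
  unfold colLabel
  split_ifs <;> simp <;> omega

theorem colLabel_eq_one {w : List Bool} {i : ℤ} : W.colLabel w i = .one ↔ i = 1 := by
  unfold colLabel
  split_ifs <;> simp <;> omega

theorem colLabel_eq_blank {w : List Bool} {i : ℤ} : W.colLabel w i = .blank ↔ w.length + 2 ≤ i := by
  unfold colLabel
  split_ifs <;> simp <;> omega

theorem colLabel_bit (w : List Bool) (t : ℕ) (ht : t < w.length) :
    W.colLabel w (t + 2) = .bit (W.state (w.take t)) w[t] := by
  unfold colLabel
  rw [if_neg (by omega), if_neg (by omega), if_neg (by omega)]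
  simp [ht]

theorem exists_of_colLabel_eq_bit {w : List Bool} {i : ℤ} {s : Fin (N + 1)} {b : Bool}
    (h : W.colLabel w i = .bit s b) : ∃ (t : ℕ) (ht : t < w.length), i = t + 2 ∧
      s = W.state (w.take t) ∧ b = w[t] := by
  unfold colLabel at h
  split_ifs at h with h1 h2 h3 h4
  refine ⟨(i - 2).toNat, h4, by omega, ?_⟩
  simpa [eq_comm] using h

theorem _root_.MSOShift.rowLabel_eq_zero {j : ℤ} : rowLabel j = .zero ↔ j = 0 := by
  unfold rowLabel
  split_ifs <;> simp <;> omega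

end Walker

/-! ### Witnesses for mismatches -/

/-- The tracks of the configuration that witnesses a mismatch: a choice of a column of the layout,
the graphs of the two coordinates of the walk, a diagonal, and the marks that carry the two
coordinates of the chosen position to the corresponding cell of the plane. -/
structure Track where
  trivial : Bool
  passed : Bool
  chosen : Bool
  diag : Bool
  graph₁ : Bool
  graph₂ : Bool
  row₁ : Bool
  row₂ : Bool
  col₁ : Bool

instance : Finite Track := by
  refine Finite.of_injective (fun z : Track => (z.trivial, z.passed, z.chosen, z.diag, z.graph₁,
    z.graph₂, z.row₁, z.row₂, z.col₁)) ?_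
  rintro ⟨⟩ ⟨⟩ h
  simpa using h

/-- The local rules of a nontrivial witness at the coordinate `u`. -/
structure Walker.NontrivialRule {m N : ℕ} (W : Walker m N)
    (lab : Config (ColLabel N × RowLabel)) (z : Config Track) (u : ℤ × ℤ) : Prop where
  chosen_north : (z u).chosen = (z (u + (0, 1))).chosen
  passed_east : ¬ (z u).passed → ¬ (z u).chosen → ¬ (z (u + (1, 0))).passed
  origin : (lab u).1 = .origin → ¬ (z u).passed ∧ ¬ (z u).chosen
  blank : (lab u).1 = .blank → (z u).passed ∧ ¬ (z u).chosen
  chosen_bit : (z u).chosen → ∃ s b, (lab u).1 = .bit s b ∧ (W.read s b).isSome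
  diag_origin : (lab u).1 = .origin → (lab u).2 = .zero →
    (z u).diag ∧ (z u).graph₁ ∧ (z u).graph₂
  diag_northEast : (z u).diag = (z (u + (1, 1))).diag
  graph_east : (lab u).1 = .origin ∨ (lab u).1 = .one →
    ((z u).graph₁ → (z (u + (1, 0))).graph₁) ∧ ((z u).graph₂ → (z (u + (1, 0))).graph₂)
  graph_bit : ∀ s b, (lab u).1 = .bit s b →
    ((z u).graph₁ → (z (u + (1, (W.disp s b).1))).graph₁) ∧
    ((z u).graph₂ → (z (u + (1, (W.disp s b).2))).graph₂)
  chosen_row : (z u).chosen → ((z u).graph₁ → (z u).row₁) ∧ ((z u).graph₂ → (z u).row₂)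
  row_east : (z u).row₁ = (z (u + (1, 0))).row₁ ∧ (z u).row₂ = (z (u + (1, 0))).row₂
  diag_col : (z u).diag → (z u).row₁ → (z u).col₁
  col_north : (z u).col₁ = (z (u + (0, 1))).col₁

/-- The rules of a witness at the coordinates `u` and `u'`. -/
def Walker.WitnessRule {m N : ℕ} (W : Walker m N) {A : Type} (e : A → Fin m) (x : Config A)
    (lab : Config (ColLabel N × RowLabel)) (z : Config Track) (u u' : ℤ × ℤ) : Prop :=
  (z u).trivial = (z u').trivial ∧
  ((z u).trivial → ¬ ((lab u).1 = .origin ∧ (lab u).2 = .zero ∧ (lab u').1 = .blank)) ∧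
  (¬ (z u).trivial → W.NontrivialRule lab z u ∧
    ((z u).col₁ → (z u).row₂ → (z u').chosen → ∀ s b c, (lab u').1 = .bit s b →
      W.read s b = some c → e (x u) ≠ c))

theorem eq_of_step_eq {α : Type} {f : ℤ → α} (h : ∀ i, f i = f (i + 1)) (i j : ℤ) : f i = f j := by
  have h0 : ∀ i, f i = f 0 := by
    intro i
    induction i with
    | zero => rfl
    | succ i ih => rw [← h, ih]
    | pred i ih => rw [h (-i - 1), ← ih]; ring_nf
  rw [h0 i, h0 j]

namespace Walker

variable {m N : ℕ} (W : Walker m N) {A : Type} {e : A → Fin m} {x : Config A}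
  {lab : Config (ColLabel N × RowLabel)} {w : List Bool} {v : ℤ × ℤ}

/-- The rules force marks to be present wherever needed and need not exclude others. Superfluous
marks are harmless, since they only demand mismatches at more cells. -/
theorem not_matches_of_witness (hlab : W.IsLayout w v lab) {z : Config Track}
    (hz : ∀ u u', W.WitnessRule e x lab z u u') :
    ¬ Matches e (W.entries w) fun u => x (v + u) := by
  intro hmatch
  have horigin : (lab v).1 = .origin ∧ (lab v).2 = .zero := by
    have := hlab 0 0
    simp only [Prod.mk_zero_zero, add_zero] at this
    simp [this, colLabel_eq_origin, rowLabel_eq_zero]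
  have hcol : ∀ i j : ℤ, (lab (v + (i, j))).1 = W.colLabel w i := fun i j => by rw [hlab]
  -- The `trivial` track is constant, and a layout has both an origin cell and a blank cell.
  have htriv : ∀ u, ¬ (z u).trivial := by
    intro u hu
    rw [(hz u v).1] at hu
    exact (hz v (v + ((w.length : ℤ) + 2, 0))).2.1 hu ⟨horigin.1, horigin.2, by
      rw [hcol, colLabel_eq_blank]⟩
  have hr : ∀ u, W.NontrivialRule lab z u := fun u => ((hz u u).2.2 (htriv u)).1
  have hassoc : ∀ i j a b : ℤ, v + (i, j) + (a, b) = v + (i + a, j + b) := fun i j a b => by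
    rw [add_assoc]; rfl
  -- Without a chosen column, `passed` would stay false from the origin column up to the first blank
  -- one, where it must be true.
  obtain ⟨k, hk⟩ : ∃ k : ℕ, (z (v + ((k : ℤ), 0))).chosen := by
    by_contra hno
    push Not at hno
    have h : ∀ k : ℕ, ¬ (z (v + ((k : ℤ), 0))).passed := by
      intro k
      induction k with
      | zero => exact ((hr _).origin (by rw [hcol, colLabel_eq_origin]; rfl)).1
      | succ k ih =>
        have := (hr _).passed_east ih (by simpa using hno k)
        rw [hassoc] at this
        simpa using this
    refine h (w.length + 2) ((hr _).blank ?_).1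
    rw [hcol, colLabel_eq_blank]
    simp
  obtain ⟨s, b, hsb, hread⟩ := (hr _).chosen_bit hk
  rw [hcol] at hsb
  obtain ⟨t, ht, hkt, rfl, rfl⟩ := W.exists_of_colLabel_eq_bit hsb
  obtain ⟨c, hc⟩ := Option.isSome_iff_exists.1 hread
  set d := W.pos (w.take t) with hd
  have hchosen : ∀ j : ℤ, (z (v + ((k : ℤ), j))).chosen := by
    intro j
    rw [eq_of_step_eq (f := fun j => (z (v + ((k : ℤ), j))).chosen) (fun j => ?_) j 0]
    · exact hk
    · rw [(hr _).chosen_north, hassoc, add_zero]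
  have hgraph : ∀ t ≤ w.length,
      (z (v + ((t : ℤ) + 2, (W.pos (w.take t)).1))).graph₁ ∧
      (z (v + ((t : ℤ) + 2, (W.pos (w.take t)).2))).graph₂ := by
    intro t ht
    induction t with
    | zero =>
      have h0 := (hr v).diag_origin horigin.1 horigin.2
      have h1 := (hr v).graph_east (Or.inl horigin.1)
      have h2 := (hr (v + (1, 0))).graph_east (Or.inr (by rw [hcol, colLabel_eq_one]))
      rw [hassoc] at h2
      exact ⟨h2.1 (h1.1 h0.2.1), h2.2 (h1.2 h0.2.2)⟩
    | succ t ih =>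
      obtain ⟨ih1, ih2⟩ := ih (by omega)
      have hb := fun j => (hr (v + ((t : ℤ) + 2, j))).graph_bit _ _
        ((hcol _ _).trans (W.colLabel_bit w t (by omega)))
      have h1 := (hb _).1 ih1
      have h2 := (hb _).2 ih2
      rw [hassoc] at h1 h2
      rw [W.pos_take_succ w t (by omega)]
      push_cast
      rw [show (t : ℤ) + 1 + 2 = t + 2 + 1 by ring]
      exact ⟨h1, h2⟩
  have hrow₁ : ∀ i : ℤ, (z (v + (i, d.1))).row₁ := by
    intro i
    rw [eq_of_step_eq (f := fun i => (z (v + (i, d.1))).row₁) (fun i => ?_) i k]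
    · refine ((hr _).chosen_row (hchosen _)).1 ?_
      rw [hkt]
      exact (hgraph t ht.le).1
    · rw [(hr _).row_east.1, hassoc, add_zero]
  have hrow₂ : ∀ i : ℤ, (z (v + (i, d.2))).row₂ := by
    intro i
    rw [eq_of_step_eq (f := fun i => (z (v + (i, d.2))).row₂) (fun i => ?_) i k]
    · refine ((hr _).chosen_row (hchosen _)).2 ?_
      rw [hkt]
      exact (hgraph t ht.le).2
    · rw [(hr _).row_east.2, hassoc, add_zero]
  -- The diagonal turns the row at height `d.1` into the column at abscissa `d.1`, which meets the
  -- row at height `d.2` in the cell `v + d`.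
  have hdiag : ∀ i : ℤ, (z (v + (i, i))).diag := by
    intro i
    rw [eq_of_step_eq (f := fun i => (z (v + (i, i))).diag) (fun i => ?_) i 0]
    · refine ((hr _).diag_origin ?_ ?_).1
      · rw [hcol, colLabel_eq_origin]
      · rw [hlab, rowLabel_eq_zero]
    · rw [(hr _).diag_northEast, hassoc]
  have hcol₁ : ∀ j : ℤ, (z (v + (d.1, j))).col₁ := by
    intro j
    rw [eq_of_step_eq (f := fun j => (z (v + (d.1, j))).col₁) (fun j => ?_) j d.1]
    · exact (hr _).diag_col (hdiag _) (hrow₁ _)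
    · rw [(hr _).col_north, hassoc, add_zero]
  refine ((hz (v + (d.1, d.2)) (v + ((k : ℤ), 0))).2.2 (htriv _)).2 (hcol₁ _) (hrow₂ _)
    (hchosen 0) _ _ c ((hcol _ _).trans hsb) hc ?_
  exact hmatch (d, c) (W.mem_entries.2 ⟨t, ht, hc, rfl⟩)

/-- The witness marks exactly the intended cells for one mismatching entry, read at time `t`, that
is, in column `t + 2`. -/
theorem exists_witness (hlab : W.IsLayout w v lab)
    (h : ¬ Matches e (W.entries w) fun u => x (v + u)) :
    ∃ z : Config Track, ∀ u u', W.WitnessRule e x lab z u u' := by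
  classical
  simp only [Matches] at h
  push Not at h
  obtain ⟨⟨d, c⟩, hdc, hne⟩ := h
  obtain ⟨t, ht, hread, hpos⟩ := W.mem_entries.1 hdc
  have key : ∀ f : ℤ → ℤ → Track, (∀ i j i' j', W.WitnessRule e x lab (fun u =>
      f (u - v).1 (u - v).2) (v + (i, j)) (v + (i', j'))) →
      ∃ z : Config Track, ∀ u u', W.WitnessRule e x lab z u u' := by
    intro f hf
    refine ⟨fun u => f (u - v).1 (u - v).2, fun u u' => ?_⟩
    have := hf (u - v).1 (u - v).2 (u' - v).1 (u' - v).2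
    rwa [Prod.mk.eta, Prod.mk.eta, add_sub_cancel, add_sub_cancel] at this
  have hlab' : ∀ i j, lab (v + (i, j)) = (W.colLabel w i, rowLabel j) := hlab
  -- In the columns before `2` the truncation of `i - 2` gives time `0`, so the graphs run
  -- horizontally from the origin to the first bit.
  refine key (fun i j =>
    { trivial := false
      passed := decide ((t : ℤ) + 2 < i)
      chosen := decide (i = t + 2)
      diag := decide (i = j)
      graph₁ := decide (j = (W.pos (w.take (i - 2).toNat)).1)
      graph₂ := decide (j = (W.pos (w.take (i - 2).toNat)).2)
      row₁ := decide (j = d.1)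
      row₂ := decide (j = d.2)
      col₁ := decide (i = d.1) }) fun i j i' j' => ⟨rfl, fun h => by simp at h, fun _ => ⟨?_, ?_⟩⟩
  · constructor
    all_goals simp only [hlab', add_sub_cancel_left, add_assoc, Prod.mk_add_mk, decide_eq_true_eq,
      colLabel_eq_origin, colLabel_eq_one, colLabel_eq_blank, rowLabel_eq_zero]
    · simp
    · omega
    · omega
    · omega
    · rintro rfl
      exact ⟨_, _, W.colLabel_bit w t ht, by simp [hread]⟩
    · rintro rfl rfl
      simp [pos, run]
    · simp
    · rintro (rfl | rfl) <;> simp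
    · intro s b hsb
      obtain ⟨r, hr, rfl, rfl, rfl⟩ := W.exists_of_colLabel_eq_bit hsb
      have h1 : ((r : ℤ) + 2 - 2).toNat = r := by omega
      have h2 : ((r : ℤ) + 2 + 1 - 2).toNat = r + 1 := by omega
      rw [h1, h2, W.pos_take_succ w r hr]
      simp
    · rintro rfl
      have h1 : ((t : ℤ) + 2 - 2).toNat = t := by omega
      rw [h1, hpos]
      exact ⟨id, id⟩
    · simp
    · rintro rfl rfl
      rfl
    · simp
  · simp only [add_sub_cancel_left, decide_eq_true_eq, hlab']
    rintro rfl rfl rfl s b c' hsb hc'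
    rw [W.colLabel_bit w t ht] at hsb
    cases hsb
    rw [hread] at hc'
    cases hc'
    exact hne

/-- The offsets that occur in the rules of a witness. -/
def offsets : Set (ℤ × ℤ) :=
  {0, (1, 0), (0, 1), (1, 1)} ∪
    (Set.range (fun q : Fin (N + 1) × Bool => ((1 : ℤ), (W.disp q.1 q.2).1)) ∪
    Set.range fun q : Fin (N + 1) × Bool => ((1 : ℤ), (W.disp q.1 q.2).2))

theorem finite_offsets : W.offsets.Finite :=
  (Set.toFinite _).union ((Set.finite_range _).union (Set.finite_range _))

theorem NontrivialRule.of_eq {lab lab' : Config (ColLabel N × RowLabel)} {z z' : Config Track}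
    {u u' : ℤ × ℤ} (h1 : lab u = lab' u') (h2 : ∀ d ∈ W.offsets, z (u + d) = z' (u' + d))
    (h : W.NontrivialRule lab z u) : W.NontrivialRule lab' z' u' := by
  have h0 : z u = z' u' := by simpa using h2 0 (by simp [offsets])
  have hE := h2 (1, 0) (by simp [offsets])
  have hN := h2 (0, 1) (by simp [offsets])
  have hNE := h2 (1, 1) (by simp [offsets])
  have hb1 : ∀ s b, z (u + (1, (W.disp s b).1)) = z' (u' + (1, (W.disp s b).1)) := fun s b =>
    h2 _ (Or.inr (Or.inl ⟨(s, b), rfl⟩))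
  have hb2 : ∀ s b, z (u + (1, (W.disp s b).2)) = z' (u' + (1, (W.disp s b).2)) := fun s b =>
    h2 _ (Or.inr (Or.inr ⟨(s, b), rfl⟩))
  obtain ⟨a1, a2, a3, a4, a5, a6, a7, a8, a9, a10, a11, a12, a13⟩ := h
  simp only [h0, hE, hN, hNE, h1, hb1, hb2] at a1 a2 a3 a4 a5 a6 a7 a8 a9 a10 a11 a12 a13
  exact ⟨a1, a2, a3, a4, a5, a6, a7, a8, a9, a10, a11, a12, a13⟩

end Walker

/-- A set described by forbidden walks is definable if the layouts of the forbidden words can be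
enforced by the labels of a subshift in the class `C`. -/
theorem mem_piBar_of_layouts {C : ShiftClass} (hC : ∀ (B : Type) [Finite B], Set.univ ∈ C B)
    {A B : Type} [Finite A] [Finite B] {m N : ℕ} (W : Walker m N) (e : A ≃ Fin m)
    {G : List Bool → Prop} {X : Set (Config A)}
    (hX : ∀ x, x ∈ X ↔ ∀ w, G w → ∀ v, ¬ Matches e (W.entries w) fun u => x (v + u))
    {Y : Set (Config B)} (hY : Y ∈ C B) (lab : B → ColLabel N × RowLabel)
    (hsound : ∀ y ∈ Y, ∀ u u', (lab (y u)).1 = .origin → (lab (y u)).2 = .zero →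
      (lab (y u')).1 = .blank → ∃ w v, G w ∧ W.IsLayout w v fun p => lab (y p))
    (hcomplete : ∀ w v, G w → ∃ y ∈ Y, W.IsLayout w v fun p => lab (y p)) (n : ℕ) :
    X ∈ PiBar (n + 2) C A := by
  have h : X = {x : Config A | ∀ y ∈ Y, ∃ z : Config Track, ∀ n : Fin 2 → ℤ × ℤ,
      W.WitnessRule e x (fun p => lab (y p)) z (n 0) (n 1)} := by
    ext x
    rw [hX]
    constructor
    · intro hx y hy
      by_cases hcase : ∃ u u', (lab (y u)).1 = .origin ∧ (lab (y u)).2 = .zero ∧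
          (lab (y u')).1 = .blank
      · obtain ⟨u, u', h1, h2, h3⟩ := hcase
        obtain ⟨w, v, hw, hlab⟩ := hsound y hy u u' h1 h2 h3
        obtain ⟨z, hz⟩ := W.exists_witness hlab (hx w hw v)
        exact ⟨z, fun n => hz _ _⟩
      -- Labellings that lack an origin cell or a blank cell, such as limits of layouts of ever
      -- longer words, may belong to the closed set `Y`; the trivial witness disposes of them.
      · refine ⟨fun _ => ⟨true, true, true, true, true, true, true, true, true⟩, fun n => ?_⟩
        exact ⟨rfl, fun _ h => hcase ⟨_, _, h⟩, fun h => absurd rfl h⟩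
    · intro hx w hw v
      obtain ⟨y, hy, hlab⟩ := hcomplete w v hw
      obtain ⟨z, hz⟩ := hx y hy
      exact W.not_matches_of_witness hlab fun u u' => hz ![u, u']
  rw [h]
  refine mem_piBar_of_local hC hY W.finite_offsets (p := fun x y z n =>
    W.WitnessRule e x (fun p => lab (y p)) z (n 0) (n 1)) ?_ n
  rintro x y z n x' y' z' n' hx hy hz ⟨h1, h2, h3⟩
  have h0 : (0 : ℤ × ℤ) ∈ W.offsets := by simp [Walker.offsets]
  have hx0 : ∀ j, x (n j) = x' (n' j) := fun j => by simpa using hx j 0 h0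
  have hy0 : ∀ j, y (n j) = y' (n' j) := fun j => by simpa using hy j 0 h0
  have hz0 : ∀ j, z (n j) = z' (n' j) := fun j => by simpa using hz j 0 h0
  refine ⟨?_, ?_, fun h => ⟨?_, ?_⟩⟩
  · rwa [← hz0, ← hz0]
  · simpa only [← hz0, ← hy0] using h2
  · rw [← hz0] at h
    exact (h3 h).1.of_eq W (congrArg lab (hy0 0)) (hz 0)
  · rw [← hz0] at h
    simpa only [← hz0, ← hy0, ← hx0] using (h3 h).2

/-! ### Local rules of layouts -/

theorem planeAdd_add (v : ℤ × ℤ) (i j a b : ℤ) : v + (i, j) + (a, b) = v + (i + a, j + b) :=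
  add_assoc v (i, j) (a, b)

theorem exists_eq_planeAdd (v u : ℤ × ℤ) : ∃ i j, u = v + (i, j) :=
  ⟨(u - v).1, (u - v).2, (add_sub_cancel v u).symm⟩

namespace Walker

variable {m N : ℕ} (W : Walker m N)

/-- The label `c'` may stand to the right of the label `c`. -/
def ColStep (c c' : ColLabel N) : Prop :=
  match c with
  | .left => c' = .left ∨ c' = .origin
  | .origin => c' = .one
  | .one => (∃ b, c' = .bit 0 b) ∨ c' = .blank
  | .bit s b => (∃ b', c' = .bit (W.next s b) b') ∨ c' = .blank
  | .blank => c' = .blank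

/-- The label `r'` may stand above the label `r`. -/
def _root_.MSOShift.RowStep (r r' : RowLabel) : Prop :=
  match r with
  | .below => r' = .below ∨ r' = .zero
  | .zero => r' = .above
  | .above => r' = .above

/-- The local rules of layouts. -/
structure LayoutRule (lab : Config (ColLabel N × RowLabel)) (u : ℤ × ℤ) : Prop where
  col_north : (lab u).1 = (lab (u + (0, 1))).1
  row_east : (lab u).2 = (lab (u + (1, 0))).2
  col_east : W.ColStep (lab u).1 (lab (u + (1, 0))).1
  row_north : RowStep (lab u).2 (lab (u + (0, 1))).2

theorem colLabel_of_neg {w : List Bool} {i : ℤ} (h : i < 0) : W.colLabel w i = .left :=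
  if_pos h

theorem colStep_colLabel (w : List Bool) (i : ℤ) :
    W.ColStep (W.colLabel w i) (W.colLabel w (i + 1)) := by
  have hbit : ∀ t : ℕ, (∃ b, W.colLabel w (t + 2) = .bit (W.state (w.take t)) b) ∨
      W.colLabel w (t + 2) = .blank := by
    intro t
    rcases Nat.lt_or_ge t w.length with h | h
    · exact Or.inl ⟨_, W.colLabel_bit w t h⟩
    · exact Or.inr (W.colLabel_eq_blank.2 (by omega))
  rcases lt_trichotomy i 0 with hi | rfl | hi
  · rw [W.colLabel_of_neg hi]
    rcases (show i + 1 ≤ 0 by omega).lt_or_eq with h | h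
    · exact Or.inl (W.colLabel_of_neg h)
    · exact Or.inr (W.colLabel_eq_origin.2 h)
  · rw [W.colLabel_eq_origin.2 rfl]
    exact W.colLabel_eq_one.2 rfl
  · rcases (show 1 ≤ i by omega).eq_or_lt with rfl | h
    · rw [W.colLabel_eq_one.2 rfl]
      exact hbit 0
    · obtain ⟨t, rfl⟩ : ∃ t : ℕ, i = t + 2 := ⟨(i - 2).toNat, by omega⟩
      rcases Nat.lt_or_ge t w.length with h | h
      · rw [W.colLabel_bit w t h]
        have := hbit (t + 1)
        rw [W.state_take_succ w t h] at this
        push_cast at this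
        rwa [show (t : ℤ) + 2 + 1 = t + 1 + 2 by ring]
      · rw [W.colLabel_eq_blank.2 (by omega)]
        exact W.colLabel_eq_blank.2 (by omega)

theorem _root_.MSOShift.rowStep_rowLabel (j : ℤ) : RowStep (rowLabel j) (rowLabel (j + 1)) := by
  unfold rowLabel
  split_ifs <;> first | omega | simp [RowStep]

theorem IsLayout.layoutRule {w : List Bool} {v : ℤ × ℤ} {lab : Config (ColLabel N × RowLabel)}
    (h : W.IsLayout w v lab) (u : ℤ × ℤ) : W.LayoutRule lab u := by
  obtain ⟨i, j, rfl⟩ := exists_eq_planeAdd v u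
  constructor
  · rw [planeAdd_add, h, h, add_zero]
  · rw [planeAdd_add, h, h, add_zero]
  · rw [planeAdd_add, h, h]
    exact W.colStep_colLabel w i
  · rw [planeAdd_add, h, h]
    exact rowStep_rowLabel j

theorem colLabel_concat (w : List Bool) (b : Bool) {i : ℤ} (hi : i < w.length + 2) :
    W.colLabel (w ++ [b]) i = W.colLabel w i := by
  rcases lt_or_ge i 2 with h | h
  · unfold colLabel
    split_ifs <;> first | rfl | omega
  · obtain ⟨t, rfl⟩ : ∃ t : ℕ, i = t + 2 := ⟨(i - 2).toNat, by omega⟩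
    have ht : t < w.length := by omega
    rw [W.colLabel_bit w t ht, W.colLabel_bit _ t (by simp; omega),
      List.take_append_of_le_length ht.le, List.getElem_append_left ht]

theorem _root_.MSOShift.rowLabel_of_rowStep {r : ℤ → RowLabel} (h0 : r 0 = .zero)
    (hr : ∀ j, RowStep (r j) (r (j + 1))) (j : ℤ) : r j = rowLabel j := by
  have hup : ∀ n : ℕ, r (n + 1) = .above := by
    intro n
    induction n with
    | zero => have := hr 0; rw [h0] at this; exact this
    | succ n ih => have := hr (n + 1); rw [ih] at this; exact_mod_cast this
  have hdown : ∀ n : ℕ, r (-(n + 1)) = .below := by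
    intro n
    induction n with
    | zero =>
      have := hr (-1)
      rw [show (-1 : ℤ) + 1 = 0 by ring, h0] at this
      cases h : r (-1) <;> rw [h] at this <;> simp_all [RowStep]
    | succ n ih =>
      have := hr (-(n + 1 + 1))
      rw [show (-((n : ℤ) + 1 + 1)) + 1 = -(n + 1) by ring, ih] at this
      push_cast
      cases h : r (-(n + 1 + 1)) <;> rw [h] at this <;> simp_all [RowStep]
  unfold rowLabel
  split_ifs with h1 h2
  · have := hdown (-j - 1).toNat
    rwa [show -(((-j - 1).toNat : ℤ) + 1) = j by omega] at this
  · rw [h2, h0]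
  · have := hup (j - 1).toNat
    rwa [show ((j - 1).toNat : ℤ) + 1 = j by omega] at this

/-- From the origin, the rules determine the labels on the left and the walker states on the right.
The blank column rules out an infinite bit sequence. -/
theorem exists_colLabel_of_colStep {c : ℤ → ColLabel N} (h0 : c 0 = .origin)
    (hc : ∀ i, W.ColStep (c i) (c (i + 1))) {i₀ : ℤ} (h_blank : c i₀ = .blank) :
    ∃ w, ∀ i, c i = W.colLabel w i := by
  have hleft : ∀ n : ℕ, c (-(n + 1)) = .left := by
    intro n
    induction n with
    | zero =>
      have := hc (-1)
      rw [show (-1 : ℤ) + 1 = 0 by ring, h0] at this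
      cases h : c (-1) <;> rw [h] at this <;> simp_all [ColStep]
    | succ n ih =>
      have := hc (-(n + 1 + 1))
      rw [show (-((n : ℤ) + 1 + 1)) + 1 = -(n + 1) by ring, ih] at this
      push_cast
      cases h : c (-(n + 1 + 1)) <;> rw [h] at this <;> simp_all [ColStep]
  have hone : c 1 = .one := by have := hc 0; rw [h0] at this; exact this
  have hnext : ∀ w : List Bool, (∀ i : ℤ, i < w.length + 2 → c i = W.colLabel w i) →
      (∃ b, c (w.length + 2) = .bit (W.state w) b) ∨ c (w.length + 2) = .blank := by
    intro w hw
    rcases List.eq_nil_or_concat' w with rfl | ⟨w, b, rfl⟩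
    · have := hc 1
      rwa [hone] at this
    · have h1 := hw (w.length + 2) (by simp)
      rw [W.colLabel_bit _ w.length (by simp)] at h1
      have h2 := hc (w.length + 2)
      rw [h1] at h2
      rw [state_concat]
      simp only [List.length_append, List.length_singleton, Nat.cast_add, Nat.cast_one]
      rw [show (w.length : ℤ) + 1 + 2 = w.length + 2 + 1 by ring]
      simpa [ColStep] using h2
  -- After `t` bits, either the word read so far fits all columns before `t + 2`, or the whole word
  -- has been found.
  have hmain : ∀ t : ℕ, (∃ w : List Bool, w.length = t ∧
      ∀ i : ℤ, i < t + 2 → c i = W.colLabel w i) ∨ ∃ w, ∀ i, c i = W.colLabel w i := by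
    intro t
    induction t with
    | zero =>
      refine Or.inl ⟨[], rfl, fun i hi => ?_⟩
      rcases lt_or_ge i 0 with h | h
      · rw [W.colLabel_of_neg h]
        have := hleft (-i - 1).toNat
        rwa [show -(((-i - 1).toNat : ℤ) + 1) = i by omega] at this
      · obtain rfl | rfl : i = 0 ∨ i = 1 := by simp at hi; omega
        · rw [h0, W.colLabel_eq_origin.2 rfl]
        · rw [hone, W.colLabel_eq_one.2 rfl]
    | succ t ih =>
      rcases ih with ⟨w, rfl, hw⟩ | h
      · rcases hnext w hw with ⟨b, hb⟩ | hs
        · refine Or.inl ⟨w ++ [b], by simp, fun i hi => ?_⟩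
          rcases (show i ≤ w.length + 2 by push_cast at hi; omega).lt_or_eq with h | rfl
          · rw [W.colLabel_concat w b h, hw i h]
          · rw [hb, W.colLabel_bit _ w.length (by simp)]
            simp
        · refine Or.inr ⟨w, fun i => ?_⟩
          rcases lt_or_ge i (w.length + 2) with h | h
          · exact hw i h
          · rw [W.colLabel_eq_blank.2 h]
            obtain ⟨n, rfl⟩ : ∃ n : ℕ, i = w.length + 2 + n :=
              ⟨(i - (w.length + 2)).toNat, by omega⟩
            clear h
            induction n with
            | zero => simpa using hs
            | succ n ih =>
              have := hc (w.length + 2 + n)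
              rw [ih] at this
              push_cast
              rwa [← add_assoc]
      · exact Or.inr h
  -- A prefix of length `i₀.toNat` would reach beyond the blank column `i₀`.
  rcases hmain i₀.toNat with ⟨w, hw, h⟩ | h
  · have h1 := h i₀ (by omega)
    rw [h_blank, eq_comm, W.colLabel_eq_blank] at h1
    omega
  · exact h

/-- The local rules determine the layouts. -/
theorem exists_isLayout {lab : Config (ColLabel N × RowLabel)} (h : ∀ u, W.LayoutRule lab u)
    {v u' : ℤ × ℤ} (h1 : (lab v).1 = .origin) (h2 : (lab v).2 = .zero)
    (h3 : (lab u').1 = .blank) : ∃ w, W.IsLayout w v lab := by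
  have hcol : ∀ i j : ℤ, (lab (v + (i, j))).1 = (lab (v + (i, 0))).1 := fun i j =>
    eq_of_step_eq (f := fun j => (lab (v + (i, j))).1)
      (fun j => by rw [(h _).col_north, planeAdd_add, add_zero]) j 0
  have hrow : ∀ i j : ℤ, (lab (v + (i, j))).2 = (lab (v + (0, j))).2 := fun i j =>
    eq_of_step_eq (f := fun i => (lab (v + (i, j))).2)
      (fun i => by rw [(h _).row_east, planeAdd_add, add_zero]) i 0
  have hv : v + (0, 0) = v := add_zero v
  obtain ⟨w, hw⟩ := W.exists_colLabel_of_colStep (c := fun i => (lab (v + (i, 0))).1)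
    (i₀ := (u' - v).1) (by simpa only [hv] using h1)
    (fun i => by
      have := (h (v + (i, 0))).col_east
      rwa [planeAdd_add, add_zero] at this)
    (by simpa only [← hcol _ (u' - v).2, Prod.mk.eta, add_sub_cancel] using h3)
  have hr := rowLabel_of_rowStep (r := fun j => (lab (v + (0, j))).2)
    (by simpa only [hv] using h2)
    (fun j => by
      have := (h (v + (0, j))).row_north
      rwa [planeAdd_add, add_zero] at this)
  exact ⟨w, fun i j => Prod.ext ((hcol i j).trans (hw i)) ((hrow i j).trans (hr j))⟩

/-- The `w'.length + 3` columns include the first blank one, so they fix the length as well as the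
bits. -/
theorem eq_of_colLabel_eq {w w' : List Bool}
    (h : ∀ i : ℕ, i < w'.length + 3 → W.colLabel w i = W.colLabel w' i) : w = w' := by
  have h1 : w.length ≤ w'.length := by
    have := h (w'.length + 2) (by omega)
    rw [W.colLabel_eq_blank.2 (show (w'.length : ℤ) + 2 ≤ ((w'.length + 2 : ℕ) : ℤ) by simp),
      W.colLabel_eq_blank] at this
    push_cast at this
    omega
  have h2 : w'.length ≤ w.length := by
    have := h (w.length + 2) (by omega)
    rw [W.colLabel_eq_blank.2 (show (w.length : ℤ) + 2 ≤ ((w.length + 2 : ℕ) : ℤ) by simp),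
      eq_comm, W.colLabel_eq_blank] at this
    push_cast at this
    omega
  refine List.ext_getElem (le_antisymm h1 h2) fun t ht ht' => ?_
  have := h (t + 2) (by omega)
  push_cast at this
  rw [W.colLabel_bit w t ht, W.colLabel_bit w' t ht'] at this
  exact (ColLabel.bit.inj this).2

/-- The canonical layout. -/
def layout (w : List Bool) (v : ℤ × ℤ) : Config (ColLabel N × RowLabel) := fun u =>
  (W.colLabel w (u - v).1, rowLabel (u - v).2)

theorem isLayout_layout (w : List Bool) (v : ℤ × ℤ) : W.IsLayout w v (W.layout w v) :=
  fun i j => by simp [layout]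

theorem layoutRule_mem_sft {B : Type} [Finite B] (lab : B → ColLabel N × RowLabel) :
    {y : Config B | ∀ u, W.LayoutRule (fun p => lab (y p)) u} ∈ SFT B := by
  have h := mem_sft_of_local (A := B) (D := {0, (1, 0), (0, 1)}) (Set.toFinite _)
    (p := fun y => W.LayoutRule (fun p => lab (y p)) 0) (fun y y' hy h => by
      have h0 := hy 0 (by simp)
      have hE := hy (1, 0) (by simp)
      have hN := hy (0, 1) (by simp)
      obtain ⟨a1, a2, a3, a4⟩ := h
      simp only [zero_add, h0, hE, hN] at a1 a2 a3 a4
      constructor <;> simpa only [zero_add])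
  convert h using 4 with y u
  constructor
  · rintro ⟨a1, a2, a3, a4⟩
    constructor <;> simpa only [zero_add, add_zero]
  · rintro ⟨a1, a2, a3, a4⟩
    simp only [zero_add, add_zero] at a1 a2 a3 a4
    exact ⟨a1, a2, a3, a4⟩

end Walker

/-! ### Layouts of arithmetically restricted words -/

theorem univ_mem_sft {A : Type} [Finite A] : Set.univ ∈ SFT A :=
  ⟨∅, Set.finite_empty, by ext; simp [avoiding]⟩

theorem ArithPi.mono {A : Type} [Finite A] {j k : ℕ} (h : j ≤ k) :
    ArithPi (j + 1) A ⊆ ArithPi (k + 1) A := fun X hX => by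
  rw [mem_arithPi_iff] at hX ⊢
  exact ⟨hX.1, hX.2.mono (by omega)⟩

namespace Walker

variable {m N M : ℕ} (W : Walker m N)

/-- The code of the row of labels that spans the layout of `w` with origin `v`. -/
def segment (e : ColLabel N × RowLabel → Fin M) (v : ℤ × ℤ) (w : List Bool) :
    List ((ℤ × ℤ) × Fin M) :=
  (List.range (w.length + 3)).map fun i : ℕ => (v + ((i : ℤ), 0), e (W.colLabel w i, .zero))

theorem colLabel_natCast (w : List Bool) (i : ℕ) : W.colLabel w i =
    if i = 0 then .origin else if i = 1 then .one else
      Option.casesOn w[i - 2]? .blank fun b => .bit (W.state (w.take (i - 2))) b := by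
  rcases Nat.lt_or_ge i 2 with h | h
  · obtain rfl | rfl : i = 0 ∨ i = 1 := by omega
    · simp [W.colLabel_eq_origin]
    · simp [W.colLabel_eq_one]
  · obtain ⟨t, rfl⟩ : ∃ t : ℕ, i = t + 2 := ⟨i - 2, by omega⟩
    rw [if_neg (by omega), if_neg (by omega), Nat.add_sub_cancel]
    push_cast
    rcases Nat.lt_or_ge t w.length with h | h
    · rw [W.colLabel_bit w t h, List.getElem?_eq_getElem h]
    · rw [W.colLabel_eq_blank.2 (by omega), List.getElem?_eq_none h]

theorem primrec_segment (e : ColLabel N × RowLabel → Fin M) :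
    Primrec fun x : (ℤ × ℤ) × List Bool => W.segment e x.1 x.2 := by
  have hlab : Primrec₂ fun (w : List Bool) (i : ℕ) => e (W.colLabel w i, .zero) := by
    have hi : Primrec fun x : List Bool × ℕ => x.2 - 2 :=
      Primrec.nat_sub.comp Primrec.snd (Primrec.const 2)
    have hstate : Primrec₂ fun (x : List Bool × ℕ) (b : Bool) =>
        e (.bit (W.state (x.1.take (x.2 - 2))) b, .zero) :=
      (Primrec.dom_finite fun q : Fin (N + 1) × Bool => e (.bit q.1 q.2, .zero)).comp
        (Primrec.pair (W.primrec_state.comp ((Primrec.list_take (α := Bool)).comp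
          (hi.comp Primrec.fst) (Primrec.fst.comp Primrec.fst))) Primrec.snd)
    have h1 : Primrec fun x : List Bool × ℕ => (Option.casesOn x.1[x.2 - 2]?
        (e (.blank, .zero)) fun b => e (.bit (W.state (x.1.take (x.2 - 2))) b, .zero) : Fin M) :=
      Primrec.option_casesOn ((Primrec.list_getElem? (α := Bool)).comp Primrec.fst hi)
        (Primrec.const _) hstate
    refine (Primrec.ite (Primrec.eq.comp Primrec.snd (Primrec.const 0))
      (Primrec.const (e (.origin, .zero)))
      (Primrec.ite (Primrec.eq.comp Primrec.snd (Primrec.const 1))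
      (Primrec.const (e (.one, .zero))) h1)).of_eq ?_
    rintro ⟨w, i⟩
    simp only [W.colLabel_natCast]
    split_ifs
    · rfl
    · rfl
    · cases w[i - 2]? <;> rfl
  have hint : Primrec fun i : ℕ => (i : ℤ) :=
    (primrec_natSubInt.comp Primrec.id (Primrec.const 0)).of_eq fun i => by simp
  exact Primrec.list_map
    (Primrec.list_range.comp (Primrec.nat_add.comp (Primrec.list_length.comp Primrec.snd)
      (Primrec.const 3)))
    (Primrec.pair (primrec_planeAdd.comp (Primrec.fst.comp Primrec.fst)
      (Primrec.pair (hint.comp Primrec.snd) (Primrec.const 0)))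
      (hlab.comp (Primrec.snd.comp Primrec.fst) Primrec.snd)).to₂

/-- The complement of `G` is Σ at level `k + 1`, so the complete rows spelling a word outside `G`
may serve as obstructions, in addition to the local rules. -/
theorem exists_arithPi_layouts {k : ℕ} {G : List Bool → Prop} (hG : IsPi (k + 1) G) :
    ∃ Y ∈ ArithPi (k + 1) (ColLabel N × RowLabel),
      (∀ y ∈ Y, ∀ u u', (y u).1 = .origin → (y u).2 = .zero → (y u').1 = .blank →
        ∃ w v, G w ∧ W.IsLayout w v y) ∧
      ∀ w v, G w → ∃ y ∈ Y, W.IsLayout w v y := by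
  let Y₁ : Set (Config (ColLabel N × RowLabel)) := {y | ∀ u, W.LayoutRule y u}
  let Y₂ : Set (Config (ColLabel N × RowLabel)) := {y | ∀ v w, ¬ G w →
    ¬ ∀ i : ℕ, i < w.length + 3 → y (v + ((i : ℤ), 0)) = (W.colLabel w i, .zero)}
  have hY₁ := mem_arithPi_iff.1 (sft_subset_arithPi_one (W.layoutRule_mem_sft id))
  refine ⟨Y₁ ∩ Y₂, mem_arithPi_iff.2 ⟨?_, ?_⟩, ?_, ?_⟩
  · rintro y ⟨h1, h2⟩ u
    refine ⟨hY₁.1 y h1 u, fun v w hw h => h2 (u + v) w hw fun i hi => ?_⟩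
    rw [add_assoc]
    exact h i hi
  · refine EffClosed.inter (hY₁.2.mono (by omega)) ?_
    obtain ⟨M, ⟨e⟩⟩ := Finite.exists_equiv_fin (ColLabel N × RowLabel)
    have hS : PrimrecPred fun x : List ((ℤ × ℤ) × Fin M) × ((ℤ × ℤ) × List Bool) =>
        x.1 = W.segment e x.2.1 x.2.2 :=
      Primrec.eq.comp Primrec.fst ((W.primrec_segment e).comp Primrec.snd)
    have hG' := hG.not.comp (Computable.snd.comp
      (Computable.snd (α := List ((ℤ × ℤ) × Fin M)) (β := (ℤ × ℤ) × List Bool)))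
    refine ⟨M, e, _, (hG'.and (isSigma_of_primrec hS _)).exists, fun y => ?_⟩
    have hmatch : ∀ v w, Matches e (W.segment e v w) y ↔
        ∀ i : ℕ, i < w.length + 3 → y (v + ((i : ℤ), 0)) = (W.colLabel w i, .zero) := by
      intro v w
      simp only [Matches, segment, List.forall_mem_map, List.mem_range, e.injective.eq_iff]
    constructor
    · rintro hy l ⟨⟨v, w⟩, hw, hlw⟩ hl
      change l = W.segment e v w at hlw
      subst hlw
      exact hy v w hw ((hmatch v w).1 hl)
    · intro hy v w hw h
      exact hy _ ⟨(v, w), hw, rfl⟩ ((hmatch v w).2 h)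
  · rintro y ⟨h1, h2⟩ u u' hu hu' hu''
    obtain ⟨w, hw⟩ := W.exists_isLayout h1 hu hu' hu''
    refine ⟨w, u, ?_, hw⟩
    by_contra hGw
    exact h2 u w hGw fun i _ => by rw [hw, rowLabel_eq_zero.2 rfl]
  · intro w v hw
    have hl := W.isLayout_layout w v
    -- A layout has only one origin column, and a segment starts there; hence the only word spelled
    -- in the layout of `w` is `w`.
    refine ⟨_, ⟨hl.layoutRule W, fun v' w' hw' h => hw' ?_⟩, hl⟩
    obtain ⟨i₀, j₀, rfl⟩ := exists_eq_planeAdd v v'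
    have h' : ∀ i : ℕ, i < w'.length + 3 → W.colLabel w (i₀ + i) = W.colLabel w' i ∧
        rowLabel j₀ = .zero := by
      intro i hi
      have := h i hi
      rw [planeAdd_add, hl, add_zero] at this
      exact Prod.mk.inj this
    obtain rfl : i₀ = 0 := by
      have := (h' 0 (by omega)).1
      rw [W.colLabel_eq_origin.2 Nat.cast_zero, Nat.cast_zero, add_zero,
        W.colLabel_eq_origin] at this
      exact this
    have hww' : w = w' := W.eq_of_colLabel_eq fun i hi => by simpa using (h' i hi).1
    exact hww' ▸ hw

end Walker

theorem arithPi_subset_piBar_arithPi {A : Type} [Finite A] (k n : ℕ) :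
    ArithPi (k + 2) A ⊆ PiBar (n + 2) (ArithPi (k + 1)) A := by
  intro X hX
  obtain ⟨m, ⟨e⟩⟩ := Finite.exists_equiv_fin A
  obtain ⟨G, hG, h⟩ := exists_forbidden_walks hX e
  obtain ⟨Y, hY, h1, h2⟩ := (unaryWalker m).exists_arithPi_layouts hG
  exact mem_piBar_of_layouts
    (fun B _ => ArithPi.mono k.zero_le (sft_subset_arithPi_one univ_mem_sft))
    (unaryWalker m) e h hY id h1 h2 n

/-! ### Turing machines for semidecidable sets of words -/

open Turing StateTransition

/-- Divergence is turned into an infinite orbit, which the rows of a configuration can display. -/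
theorem not_dom_eval_iff {σ : Type} {f : σ → Option σ} {a : σ} : ¬ (eval f a).Dom ↔
    ∃ c : ℕ → σ, c 0 = a ∧ ∀ n, f (c n) = some (c (n + 1)) := by
  constructor
  · intro h
    have hr : ∀ b, Reaches f a b → ∃ b', f b = some b' := fun b hb =>
      Option.ne_none_iff_exists'.1 fun hn => h (Part.dom_iff_mem.2 ⟨b, mem_eval.2 ⟨hb, hn⟩⟩)
    let c : ℕ → σ := fun n => Nat.rec a (fun _ x => (f x).getD x) n
    have hc : ∀ n, Reaches f a (c n) ∧ f (c n) = some (c (n + 1)) := by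
      intro n
      induction n with
      | zero =>
        obtain ⟨b, hb⟩ := hr a .refl
        exact ⟨.refl, hb.trans (congrArg some (by simp [c, hb]))⟩
      | succ n ih =>
        have h1 : Reaches f a (c (n + 1)) := ih.1.tail ih.2
        obtain ⟨b, hb⟩ := hr _ h1
        exact ⟨h1, hb.trans (congrArg some (show b = (f (c (n + 1))).getD (c (n + 1)) by simp [hb]))⟩
    exact ⟨c, rfl, fun n => (hc n).2⟩
  · rintro ⟨c, rfl, hc⟩ h
    obtain ⟨b, hb⟩ := Part.dom_iff_mem.1 h
    obtain ⟨h1, h2⟩ := mem_eval.1 hb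
    have : ∃ n, b = c n := by
      clear h2 hb
      induction h1 with
      | refl => exact ⟨0, rfl⟩
      | tail _ h ih =>
        obtain ⟨n, rfl⟩ := ih
        exact ⟨n + 1, (Option.some.inj ((hc n).symm.trans h)).symm⟩
    obtain ⟨n, rfl⟩ := this
    exact Option.some_ne_none _ ((hc n).symm.trans h2)

/-- The alphabet of the machines that simulate four stacks. -/
abbrev StackSymbol : Type := TM2to1.Γ' PartrecToTM2.K' fun _ => PartrecToTM2.Γ'

instance : Finite PartrecToTM2.K' :=
  Finite.of_surjective (fun i : Fin 4 =>
    if i = 0 then PartrecToTM2.K'.main else if i = 1 then .rev else if i = 2 then .aux else .stack)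
    fun k => by cases k; exacts [⟨0, rfl⟩, ⟨1, rfl⟩, ⟨2, rfl⟩, ⟨3, rfl⟩]

instance : Finite StackSymbol :=
  inferInstanceAs (Finite (Bool × (PartrecToTM2.K' → Option PartrecToTM2.Γ')))

/-- A partial recursive function is compiled to a code, to a machine with four stacks, and down to a
one-tape `TM0` machine. Each translation preserves halting and a finite set of reachable states, as
needed for a finite alphabet of cells. -/
theorem exists_machine_of_partrec {f : ℕ →. ℕ} (hf : Partrec f) :
    ∃ (Λ : Type) (_ : Inhabited Λ) (M : TM0.Machine StackSymbol Λ) (S : Finset Λ),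
      TM0.Supports M (S : Set Λ) ∧ ∀ n,
        (TM0.eval M (TM2to1.trInit .main (PartrecToTM2.trList [n]))).Dom ↔ (f n).Dom := by
  obtain ⟨c, hc⟩ := ToPartrec.Code.exists_code (Nat.Partrec'.part_iff₁.2 hf)
  -- The default state is the starting state, so it has to be the entry point of the compiled code.
  let _ : Inhabited PartrecToTM2.Λ' := ⟨PartrecToTM2.trNormal c .halt⟩
  have h2 := PartrecToTM2.tr_supports c .halt
  have h1 := TM2to1.tr_supports _ h2
  have h0 := TM1to0.tr_supports _ h1
  refine ⟨_, inferInstance, _, _, h0, fun n => ?_⟩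
  have hinit : TM2.init PartrecToTM2.K'.main (PartrecToTM2.trList [n]) =
      PartrecToTM2.init c [n] := by
    unfold TM2.init PartrecToTM2.init
    congr 1
    funext k
    cases k <;> rfl
  have h3 : (TM2.eval PartrecToTM2.tr .main (PartrecToTM2.trList [n])).Dom ↔
      (eval (TM2.step PartrecToTM2.tr) (PartrecToTM2.init c [n])).Dom := by
    rw [← hinit]
    rfl
  have h4 : c.eval [n] = pure <$> f n := hc ⟨[n], rfl⟩
  refine (iff_of_eq (congrArg Part.Dom (TM1to0.tr_eval _ _))).trans
    ((TM2to1.tr_eval_dom (M := PartrecToTM2.tr) .main _).trans (h3.trans ?_))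
  rw [PartrecToTM2.tr_eval, h4]
  rfl

/-- The number whose binary digits are the letters of `w`, after a leading digit `1`. -/
def wordNat (w : List Bool) : ℕ :=
  w.foldl (fun n b => bif b then 2 * n + 1 else 2 * n) 1

theorem primrec_wordNat : Primrec wordNat := by
  have h : Primrec₂ fun (_ : List Bool) (x : ℕ × Bool) =>
      bif x.2 then 2 * x.1 + 1 else 2 * x.1 := by
    have h2 : Primrec fun x : List Bool × (ℕ × Bool) => 2 * x.2.1 :=
      Primrec.nat_mul.comp (Primrec.const 2) (Primrec.fst.comp Primrec.snd)
    exact Primrec.cond (Primrec.snd.comp Primrec.snd) (Primrec.succ.comp h2) h2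
  exact Primrec.list_foldl Primrec.id (Primrec.const 1) h

/-- The stack symbol of a bit. -/
def bitSymbol (b : Bool) : PartrecToTM2.Γ' :=
  bif b then .bit1 else .bit0

/-- Stacks hold binary digits with the lowest first, so the word appears reversed and its leading
`1` comes last. -/
theorem trNat_wordNat (w : List Bool) :
    PartrecToTM2.trNat (wordNat w) = w.reverse.map bitSymbol ++ [.bit1] := by
  have h : ∀ w : List Bool, ∃ p : PosNum, (p : ℕ) = wordNat w ∧
      PartrecToTM2.trPosNum p = w.reverse.map bitSymbol ++ [.bit1] := by
    intro w
    induction w using List.reverseRecOn with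
    | nil => exact ⟨1, rfl, rfl⟩
    | append_singleton w b ih =>
      obtain ⟨p, h1, h2⟩ := ih
      cases b
      · refine ⟨.bit0 p, ?_, ?_⟩
        · simp only [wordNat, List.foldl_append, PosNum.cast_bit0, h1]
          simp [two_mul]
        · simp [PartrecToTM2.trPosNum, h2, bitSymbol]
      · refine ⟨.bit1 p, ?_, ?_⟩
        · simp only [wordNat, List.foldl_append, PosNum.cast_bit1, h1]
          simp [two_mul]
        · simp [PartrecToTM2.trPosNum, h2, bitSymbol]
  obtain ⟨p, h1, h2⟩ := h w
  rw [PartrecToTM2.trNat, ← h1, ← h2, ← Num.cast_pos, Num.of_to_nat]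
  rfl

theorem wordNat_injective : Function.Injective wordNat := by
  intro w w' h
  have h1 := trNat_wordNat w
  rw [h, trNat_wordNat] at h1
  have hb : Function.Injective bitSymbol := by
    intro a b
    cases a <;> cases b <;> simp [bitSymbol]
  exact List.reverse_injective (List.map_injective_iff.2 hb (List.append_cancel_right h1)).symm

theorem exists_partrec_dom_iff {G : List Bool → Prop} (hG : IsPi 1 G) :
    ∃ f : ℕ →. ℕ, Partrec f ∧ ∀ w, G w ↔ ¬ (f (wordNat w)).Dom := by
  obtain ⟨q, hq, hGq⟩ := isPi_succ.1 hG
  obtain ⟨_, hq⟩ := isSigma_zero.1 hq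
  -- On input `n`, the search runs over pairs of a word and a counterexample to `q`, keeping those
  -- whose word has number `n`; thus `wordNat` need not be inverted.
  let t : ℕ → ℕ → Bool := fun n k => Option.casesOn (Encodable.decode (α := List Bool × ℕ) k) false
    fun x => decide (wordNat x.1 = n) && !decide (q x)
  have ht : Computable₂ t := by
    have h1 : Computable₂ fun (p : ℕ × ℕ) (x : List Bool × ℕ) =>
        decide (wordNat x.1 = p.1) && !decide (q x) := by
      have h2 : PrimrecPred fun y : (ℕ × ℕ) × List Bool × ℕ => wordNat y.2.1 = y.1.1 :=
        Primrec.eq.comp (primrec_wordNat.comp (Primrec.fst.comp Primrec.snd))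
          (Primrec.fst.comp Primrec.fst)
      exact Primrec.and.to_comp.comp h2.decide.to_comp
        (Primrec.not.to_comp.comp (hq.comp Computable.snd))
    exact Computable.option_casesOn (Computable.decode.comp Computable.snd)
      (Computable.const false) h1
  refine ⟨fun n => Nat.rfind fun k => Part.some (t n k), Partrec.rfind ht.partrec₂, fun w => ?_⟩
  refine (hGq w).trans (not_iff_not.1 (Iff.trans ?_ not_not.symm))
  rw [not_forall]
  refine Iff.trans ?_ (Nat.rfind_dom (p := fun k => Part.some (t (wordNat w) k))).symm
  constructor
  · rintro ⟨m, hm⟩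
    exact ⟨Encodable.encode (w, m), by simp [t, hm], fun _ => trivial⟩
  · rintro ⟨k, hk, -⟩
    have hk : t (wordNat w) k = true := (Part.mem_some_iff.1 hk).symm
    rcases hd : Encodable.decode (α := List Bool × ℕ) k with _ | x
    · simp only [t, hd, Bool.false_eq_true] at hk
    · simp only [t, hd, Bool.and_eq_true, decide_eq_true_eq, Bool.not_eq_true',
        decide_eq_false_iff_not] at hk
      obtain ⟨h1, h2⟩ := hk
      exact ⟨x.2, by rwa [← wordNat_injective h1]⟩

/-- The tape symbol with a symbol `a` on the main stack and with the bottom mark `b`. -/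
def stackSymbol (b : Bool) (a : PartrecToTM2.Γ') : StackSymbol :=
  (b, Function.update (fun _ => none) .main (some a))

theorem trInit_reverse_cons (a : PartrecToTM2.Γ') (l : List PartrecToTM2.Γ') :
    TM2to1.trInit PartrecToTM2.K'.main (a :: l).reverse =
      stackSymbol true a :: l.map (stackSymbol false) := by
  unfold TM2to1.trInit
  rw [List.reverse_reverse]
  rfl

namespace Walker

variable {m N : ℕ} (W : Walker m N)

/-- The symbol that a column of a layout contributes to the initial tape. -/
def _root_.MSOShift.ColLabel.symbol : ColLabel N → StackSymbol
  | .origin => stackSymbol true .cons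
  | .one => stackSymbol false .bit1
  | .bit _ b => stackSymbol false (bitSymbol b)
  | _ => default

/-- The initial tape consists of the end mark `cons`, the leading digit `1`, and then the bits of
`w`. This is why layouts reserve the columns `0` and `1`. -/
theorem mk₁_trInit_nth (w : List Bool) (i : ℤ) :
    (Tape.mk₁ (TM2to1.trInit .main (PartrecToTM2.trList [wordNat w]))).nth i =
      (W.colLabel w i).symbol := by
  have h : PartrecToTM2.trList [wordNat w] = (.cons :: .bit1 :: w.map bitSymbol).reverse := by
    simp [trNat_wordNat]
  rw [h, trInit_reverse_cons]
  rcases lt_or_ge i 0 with hi | hi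
  · obtain ⟨n, rfl⟩ : ∃ n : ℕ, i = -(n + 1 : ℕ) := ⟨(-i - 1).toNat, by omega⟩
    rw [W.colLabel_of_neg hi]
    change (ListBlank.mk ([] : List StackSymbol)).nth n = default
    simp
  · obtain ⟨n, rfl⟩ : ∃ n : ℕ, i = n := ⟨i.toNat, by omega⟩
    refine (Tape.mk'_nth_nat _ _ _).trans ?_
    rw [ListBlank.nth_mk]
    match n with
    | 0 => rw [W.colLabel_eq_origin.2 Nat.cast_zero]; rfl
    | 1 => rw [W.colLabel_eq_one.2 Nat.cast_one]; rfl
    | t + 2 =>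
      rw [List.getI_eq_getElem?_getD]
      push_cast
      rcases Nat.lt_or_ge t w.length with h | h
      · rw [W.colLabel_bit w t h]
        simp [h, ColLabel.symbol]
      · rw [W.colLabel_eq_blank.2 (by omega)]
        simp [h, ColLabel.symbol]

end Walker

open Turing StateTransition

/-! ### Runs of Turing machines as configurations -/

open Classical in
/-- The symbol that the statement `s` puts in a cell with the symbol `c` and with the neighbours `l`
and `r`, on a tape that moves under a fixed head; `o` tells whether the cell is under the head. -/
noncomputable def cellUpdate {Γ : Type} (s : TM0.Stmt Γ) (o : Prop) (l c r : Γ) : Γ :=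
  match s with
  | .move .left => l
  | .move .right => r
  | .write a => if o then a else c

theorem exists_of_step_eq_some {Γ Λ : Type} [Inhabited Γ] [Inhabited Λ] {M : TM0.Machine Γ Λ}
    {c c' : TM0.Cfg Γ Λ} (h : TM0.step M c = some c') :
    ∃ s, M c.q c.Tape.head = some (c'.q, s) ∧ ∀ i, c'.Tape.nth i =
      cellUpdate s (i = 0) (c.Tape.nth (i - 1)) (c.Tape.nth i) (c.Tape.nth (i + 1)) := by
  obtain ⟨q, T⟩ := c
  obtain ⟨⟨q', s⟩, h1, rfl⟩ := Option.map_eq_some_iff.1 h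
  refine ⟨s, h1, fun i => ?_⟩
  rcases s with (_ | _) | a
  · exact T.move_left_nth i
  · exact T.move_right_nth i
  · refine (T.write_nth a).trans ?_
    simp only [cellUpdate]

/-- The cells of a layout in which every row at or above the origin row carries a configuration of a
machine. -/
structure RunCell (N : ℕ) (Q Γ : Type) where
  label : ColLabel N × RowLabel
  state : Q
  head : Γ
  cell : Γ

instance (N : ℕ) (Q Γ : Type) [Finite Q] [Finite Γ] : Finite (RunCell N Q Γ) := by
  refine Finite.of_injective (fun z : RunCell N Q Γ => (z.label, z.state, z.head, z.cell)) ?_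
  rintro ⟨⟩ ⟨⟩ h
  simpa using h

/-- The local rules of a run, for a cell `c` with the neighbours `n`, `e` and `w`. -/
structure RunRule {N : ℕ} {Λ : Type} [Inhabited Λ] (M : TM0.Machine StackSymbol Λ) {S : Finset Λ}
    (c n e w : RunCell N S StackSymbol) : Prop where
  state_east : c.state = e.state
  head_east : c.head = e.head
  head_origin : c.label.1 = .origin → c.head = c.cell
  start : c.label.2 = .zero → (c.state : Λ) = default ∧ c.cell = c.label.1.symbol
  step : c.label.2 ≠ .below → ∃ s, M c.state c.head = some ((n.state : Λ), s) ∧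
    n.cell = cellUpdate s (c.label.1 = .origin) w.cell c.cell e.cell

theorem SFT.inter {A : Type} [Finite A] {X Y : Set (Config A)} (hX : X ∈ SFT A) (hY : Y ∈ SFT A) :
    X ∩ Y ∈ SFT A := by
  obtain ⟨F, hF, rfl⟩ := hX
  obtain ⟨F', hF', rfl⟩ := hY
  refine ⟨F ∪ F', hF.union hF', ?_⟩
  ext x
  simp only [avoiding, Set.mem_inter_iff, Set.mem_ofPred_eq, Set.mem_union, or_imp, forall_and]

theorem runRule_mem_sft {N : ℕ} {Λ : Type} [Inhabited Λ] (M : TM0.Machine StackSymbol Λ)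
    (S : Finset Λ) : {y : Config (RunCell N S StackSymbol) | ∀ u,
      RunRule M (y u) (y (u + (0, 1))) (y (u + (1, 0))) (y (u + (-1, 0)))} ∈
      SFT (RunCell N S StackSymbol) := by
  have h := mem_sft_of_local (A := RunCell N S StackSymbol)
    (D := {0, (0, 1), (1, 0), (-1, 0)}) (Set.toFinite _)
    (p := fun y => RunRule M (y 0) (y (0, 1)) (y (1, 0)) (y (-1, 0))) (fun y y' hy h => by
      rwa [hy 0 (by simp), hy (0, 1) (by simp), hy (1, 0) (by simp), hy (-1, 0) (by simp)] at h)
  simpa only [add_zero] using h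

namespace Walker

variable {m N : ℕ} (W : Walker m N)

section

variable {Λ : Type} [Inhabited Λ] {M : TM0.Machine StackSymbol Λ} {S : Finset Λ} {w : List Bool}
  {v : ℤ × ℤ}

/-- State and scanned symbol are constant along each row, so all cells apply the same statement and
successive rows form an infinite run. -/
theorem not_dom_eval_of_runRule {y : Config (RunCell N S StackSymbol)}
    (hy : ∀ u, RunRule M (y u) (y (u + (0, 1))) (y (u + (1, 0))) (y (u + (-1, 0))))
    (hl : W.IsLayout w v fun p => (y p).label) {l : List StackSymbol}
    (h : ∀ i, (Tape.mk₁ l).nth i = (W.colLabel w i).symbol) : ¬ (TM0.eval M l).Dom := by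
  replace hl : ∀ i j : ℤ, (y (v + (i, j))).label = (W.colLabel w i, rowLabel j) := hl
  have hstate : ∀ i j : ℤ, (y (v + (i, j))).state = (y (v + (0, j))).state := fun i j =>
    eq_of_step_eq (f := fun i => (y (v + (i, j))).state)
      (fun i => by rw [(hy _).state_east, planeAdd_add, add_zero]) i 0
  have hhead : ∀ i j : ℤ, (y (v + (i, j))).head = (y (v + (0, j))).head := fun i j =>
    eq_of_step_eq (f := fun i => (y (v + (i, j))).head)
      (fun i => by rw [(hy _).head_east, planeAdd_add, add_zero]) i 0
  -- Row `n` displays the configuration `c`, with the head fixed at the origin column and the tape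
  -- moving under it.
  let Good : ℕ → TM0.Cfg StackSymbol Λ → Prop := fun n c =>
    c.q = (y (v + (0, (n : ℤ)))).state ∧ ∀ i, c.Tape.nth i = (y (v + (i, (n : ℤ)))).cell
  have hstep : ∀ n c, Good n c → ∃ c', TM0.step M c = some c' ∧ Good (n + 1) c' := by
    rintro n c ⟨h1, h2⟩
    have hrow : ∀ i : ℤ, ∃ s, M (y (v + (i, (n : ℤ)))).state (y (v + (i, (n : ℤ)))).head =
        some ((y (v + (i, (n : ℤ) + 1))).state.1, s) ∧ (y (v + (i, (n : ℤ) + 1))).cell =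
        cellUpdate s (i = 0) (y (v + (i - 1, (n : ℤ)))).cell (y (v + (i, (n : ℤ)))).cell
          (y (v + (i + 1, (n : ℤ)))).cell := by
      intro i
      have hlab := hl i n
      obtain ⟨s, h3, h4⟩ := (hy (v + (i, (n : ℤ)))).step (by
        rw [hlab]
        unfold rowLabel
        split_ifs <;> simp; omega)
      simp only [planeAdd_add, add_zero, hlab, W.colLabel_eq_origin] at h3 h4
      exact ⟨s, h3, h4⟩
    have hc : c.Tape.head = (y (v + (0, (n : ℤ)))).head := by
      rw [(hy _).head_origin ((congrArg Prod.fst (hl 0 n)).trans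
        ((W.colLabel_eq_origin (w := w)).2 rfl)), ← h2]
      rfl
    obtain ⟨s, hs, -⟩ := hrow 0
    rw [← h1, ← hc] at hs
    have hs' : TM0.step M c = _ := congrArg (Option.map _) hs
    rw [Option.map_some] at hs'
    refine ⟨_, hs', ?_⟩
    obtain ⟨s', h5, h6⟩ := exists_of_step_eq_some hs'
    rw [hs, Option.some_inj, Prod.mk.injEq] at h5
    refine ⟨by push_cast; rfl, fun i => ?_⟩
    obtain ⟨s'', h7, h8⟩ := hrow i
    rw [hstate, hhead, ← h1, ← hc, hs, Option.some_inj, Prod.mk.injEq] at h7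
    push_cast
    rw [h6, h8, h2, h2, h2, ← h7.2, ← h5.2]
  have h0 : Good 0 (TM0.init l) := by
    have hz : ∀ i : ℤ, (y (v + (i, ((0 : ℕ) : ℤ)))).label = (W.colLabel w i, .zero) := fun i => by
      rw [← rowLabel_eq_zero.2 (Nat.cast_zero (R := ℤ))]
      exact hl i _
    refine ⟨((hy _).start (by rw [hz])).1.symm, fun i => ?_⟩
    rw [((hy _).start (by rw [hz])).2, hz]
    exact h i
  choose! next hnext using hstep
  let c : ℕ → TM0.Cfg StackSymbol Λ := fun n => Nat.rec (TM0.init l) (fun n c => next n c) n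
  have hc : ∀ n, Good n (c n) := by
    intro n
    induction n with
    | zero => exact h0
    | succ n ih => exact (hnext n _ ih).2
  exact not_dom_eval_iff.2 ⟨c, rfl, fun n => (hnext n _ (hc n)).1⟩

theorem exists_runRule_of_not_dom (hS : TM0.Supports M (S : Set Λ)) {l : List StackSymbol}
    (h : ∀ i, (Tape.mk₁ l).nth i = (W.colLabel w i).symbol) (hM : ¬ (TM0.eval M l).Dom) :
    ∃ y : Config (RunCell N S StackSymbol), (fun p => (y p).label) = W.layout w v ∧
      ∀ u, RunRule M (y u) (y (u + (0, 1))) (y (u + (1, 0))) (y (u + (-1, 0))) := by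
  obtain ⟨c, hc0, hc⟩ := not_dom_eval_iff.1 hM
  have hq : ∀ n, (c n).q ∈ S := by
    intro n
    induction n with
    | zero => rw [hc0]; exact hS.1
    | succ n ih => exact TM0.step_supports M hS (hc n) ih
  -- Below the origin row, `toNat` repeats the initial configuration; no step is required there.
  let y : Config (RunCell N S StackSymbol) := fun u =>
    { label := W.layout w v u
      state := ⟨(c (u - v).2.toNat).q, hq _⟩
      head := (c (u - v).2.toNat).Tape.head
      cell := (c (u - v).2.toNat).Tape.nth (u - v).1 }
  have hy : ∀ i j : ℤ, y (v + (i, j)) =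
      ⟨(W.colLabel w i, rowLabel j), ⟨(c j.toNat).q, hq _⟩, (c j.toNat).Tape.head,
        (c j.toNat).Tape.nth i⟩ := by
    intro i j
    simp [y, layout]
  refine ⟨y, rfl, fun u => ?_⟩
  obtain ⟨i, j, rfl⟩ := exists_eq_planeAdd v u
  simp only [planeAdd_add, hy, add_zero]
  refine ⟨rfl, rfl, fun h1 => ?_, fun h1 => ?_, fun h1 => ?_⟩
  · rw [W.colLabel_eq_origin.1 h1]
    rfl
  · obtain rfl := rowLabel_eq_zero.1 h1
    refine ⟨by simp [hc0, TM0.init], ?_⟩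
    simp only [Int.toNat_zero, hc0]
    exact h i
  · obtain ⟨n, rfl⟩ : ∃ n : ℕ, j = n := ⟨j.toNat, by
      by_contra hj
      exact h1 (if_pos (by omega))⟩
    obtain ⟨s, h2, h3⟩ := exists_of_step_eq_some (hc n)
    refine ⟨s, h2, ?_⟩
    simp only [W.colLabel_eq_origin]
    exact h3 i

end

/-- A word is in `G` iff the machine runs forever on it, and infinite runs are described by local
rules; the run determines no extra freedom in the layout. -/
theorem exists_sft_layouts {G : List Bool → Prop} (hG : IsPi 1 G) :
    ∃ (B : Type) (_ : Finite B) (lab : B → ColLabel N × RowLabel), ∃ Y ∈ SFT B,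
      (∀ y ∈ Y, ∀ u u', (lab (y u)).1 = .origin → (lab (y u)).2 = .zero →
        (lab (y u')).1 = .blank → ∃ w v, G w ∧ W.IsLayout w v fun p => lab (y p)) ∧
      ∀ w v, G w → ∃ y ∈ Y, W.IsLayout w v fun p => lab (y p) := by
  obtain ⟨f, hf, hGf⟩ := exists_partrec_dom_iff hG
  obtain ⟨Λ, _, M, S, hS, hM⟩ := exists_machine_of_partrec hf
  refine ⟨RunCell N S StackSymbol, inferInstance, RunCell.label, _,
    SFT.inter (W.layoutRule_mem_sft RunCell.label) (runRule_mem_sft M S), ?_, ?_⟩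
  · rintro y ⟨h1, h2⟩ u u' hu hu' hu''
    obtain ⟨w, hw⟩ := W.exists_isLayout h1 hu hu' hu''
    refine ⟨w, u, (hGf w).2 fun h => ?_, hw⟩
    exact W.not_dom_eval_of_runRule h2 hw (W.mk₁_trInit_nth w) ((hM _).2 h)
  · intro w v hw
    obtain ⟨y, h1, h2⟩ := W.exists_runRule_of_not_dom (v := v) hS (W.mk₁_trInit_nth w)
      (fun h => (hGf w).1 hw ((hM _).1 h))
    have hl : W.IsLayout w v fun p => (y p).label := h1 ▸ W.isLayout_layout w v
    exact ⟨y, ⟨hl.layoutRule W, h2⟩, hl⟩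

end Walker

theorem arithPi_two_subset_piBar_sft {A : Type} [Finite A] (n : ℕ) :
    ArithPi 2 A ⊆ PiBar (n + 2) SFT A := by
  intro X hX
  obtain ⟨m, ⟨e⟩⟩ := Finite.exists_equiv_fin A
  obtain ⟨G, hG, h⟩ := exists_forbidden_walks (k := 0) hX e
  obtain ⟨B, _, lab, Y, hY, h1, h2⟩ := (unaryWalker m).exists_sft_layouts hG
  exact mem_piBar_of_layouts (fun B _ => univ_mem_sft) (unaryWalker m) e h hY lab h1 h2 n

end MSOShift

theorem mainTheorem2 :
    (∀ k n : ℕ, 1 ≤ k → 2 ≤ n →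
      MSOShift.PiBar n (MSOShift.ArithPi k) = MSOShift.ArithPi (k + 1)) ∧
    (∀ n : ℕ, 2 ≤ n → MSOShift.PiBar n MSOShift.SFT = MSOShift.ArithPi 2) := by
  constructor
  · intro k n hk hn
    obtain ⟨k, rfl⟩ := Nat.exists_eq_add_of_le' hk
    obtain ⟨n, rfl⟩ := Nat.exists_eq_add_of_le' hn
    funext A _
    exact (MSOShift.piBar_subset_arithPi).antisymm (MSOShift.arithPi_subset_piBar_arithPi k n)
  · intro n hn
    obtain ⟨n, rfl⟩ := Nat.exists_eq_add_of_le' hn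
    funext A _
    -- The upper bound for SFTs is the case of Π⁰_1, which contains them.
    exact ((MSOShift.PiBar.mono (fun B _ => MSOShift.sft_subset_arithPi_one) _).trans
      (MSOShift.piBar_subset_arithPi (k := 0))).antisymm (MSOShift.arithPi_two_subset_piBar_sft n)
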